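/- **Setting.** Let $I_1, I_2, \dots$ be closed real intervals $I_j=[l_j,r_j]$, $l_j\le r_j$ (repetitions allowed). For $n \ge 1$ let $G_n$ be the interval graph on $\{1,\dots,n\}$ in which $i\ne j$ are adjacent iff $I_i\cap I_j\neq\emptyset$; let $\omega_n$ be the size of a largest clique of $G_n$ and $\Delta_n$ its maximum degree. **KT-SLS** assigns to $I_i$ the color $(L(I_i),o(I_i))$ as follows. For a real $t$ let $h_t$ be the least non-negative integer that is not the level $L(I_j)$ of any interval $I_j\ni t$ with $j<i$. Then $L(I_i)=\max_{t\in I_i}h_t$, and $o(I_i)$ is the least element of $\{1,2,3\}$ different from $o(I_j)$ for all $j<i$ with $I_j\cap I_i\ne\emptyset$ and $L(I_j)=L(I_i)$. **handle-Insert** keeps: a balanced interval tree of all inserted intervals; a balanced interval tree $\mathcal E$ of all distinct endpoints; a table $T$ of interval trees, $T[h]$ holding the intervals of level $h$; the level and offset of each interval; and, for each endpoint $t\in\mathcal E$, a dynamic array $A_t$ of bits ($A_t[l]=1$ iff some interval of level $l$ contains $t$) together with a doubly linked list $Q_t$ of the indices $l$ with $A_t[l]=0$ in increasing order, whose nodes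 are accessible by index. The height stored at $t$ is the head of $Q_t$, or the length of $A_t$ if $Q_t$ is empty. To insert $I_i=[l_i,r_i]$ it inserts $I_i$ into the interval tree; for each of $l_i,r_i$ not yet in $\mathcal E$ it builds $A_t,Q_t$ from the levels of the earlier intervals containing that point (found by an intersection query) and inserts the point into $\mathcal E$; it queries $S=\mathcal E\cap I_i$ and sets $L(I_i)$ to the maximum stored height over $S$; for every $t\in S$ it extends $A_t$ and $Q_t$ beyond index $L(I_i)$ if necessary, sets $A_t[L(I_i)]=1$ and deletes $L(I_i)$ from $Q_t$; finally it queries $T[L(I_i)]$ for the intervals meeting $I_i$, sets $o(I_i)$ to the least offset in $\{1,2,3\}$ not used by them, and inserts $I_i$ into $T[L(I_i)]$. Time is the number of elementary steps (comparisons of endpoints, arithmetic on indices, pointer and array accesses; the reallocation of a full dynamic array to about twice its capacity costs the number of cells allocated and copied). **Theorem.** There is an absolute constant $C>0$ such that for every sequence $I_1,I_2,\dots$ of intervals, inserted one by one by handle-Insert into the initially empty data structure: 1. for every $n\ge2$, the first $n$ insertions take total time at most $n\cdot C(\log n+\Delta_n)$, i.e. the amortized time per insertion is $O(\log n+\Delta_n)$;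 2. for every $n$, after $n$ insertions the color stored for each $I_i$, $i\le n$, is the color $(L(I_i),o(I_i))$ defined by KT-SLS (in particular that color is well defined, and it never changes); 3. for every $n\ge1$, after $n$ insertions the stored colors form a proper coloring of $G_n$ that uses at most $3\omega_n-2$ distinct colors. -/

import Mathlib

/-!
Incremental colouring of intervals.

The first part fixes the cost model.  A program is a value of `Timed β`: a result together with the
number of elementary steps spent on it.  Elementary steps, each of cost one, are: comparing two
endpoints, arithmetic and comparison on natural numbers (levels, sizes, indices), following a
pointer, allocating or overwriting a record of constant size, reading or writing one cell of an
array.  Programs are assembled from `op` (one elementary step) by sequencing, branching on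
a computed boolean or pointer, and recursion; each recursive call executes at least one `op`.
The only step of non-constant cost is the reallocation of a full dynamic array, which is charged
for the cells it allocates and the cells it copies.
-/

namespace IntervalColoring

/-! ### Cost model -/

/-- A result together with the number of elementary steps that were used to compute it. -/
structure Timed (β : Type) where
  val : β
  time : ℕ

namespace Timed

instance : Monad Timed where
  pure x := ⟨x, 0⟩
  bind x f := ⟨(f x.val).val, x.time + (f x.val).time⟩

end Timed

/-- One elementary step with result `x`. -/
def op {β : Type} (x : β) : Timed β := ⟨x, 1⟩

/-- `k` elementary steps. -/
def charge (k : ℕ) : Timed Unit := ⟨(), k⟩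

/-! ### Dynamic arrays -/

/-- A dynamic array: a block of `cap` cells, of which the first `elems.size` are in use. -/
structure DynArray (β : Type) where
  elems : Array β
  cap : ℕ

namespace DynArray

variable {β : Type}

def empty : DynArray β := ⟨#[], 0⟩

def size (a : DynArray β) : Timed ℕ := op a.elems.size

/-- Read cell `i`; `none` if the index is out of range. -/
def get (a : DynArray β) (i : ℕ) : Timed (Option β) := op a.elems[i]?

/-- Overwrite cell `i` in place. -/
def set (a : DynArray β) (i : ℕ) (x : β) : Timed (DynArray β) :=
  op ⟨a.elems.setIfInBounds i x, a.cap⟩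

/-- Append a cell.  A full block is replaced by a block of (about) twice the capacity: all cells of
the new block are allocated and all cells in use are copied. -/
def push (a : DynArray β) (x : β) : Timed (DynArray β) := do
  let full ← op (decide (a.cap ≤ a.elems.size))
  if full then
    let c ← op (2 * a.cap + 1)
    charge (c + a.elems.size)
    op ⟨a.elems.push x, c⟩
  else
    op ⟨a.elems.push x, a.cap⟩

end DynArray

/-! ### Interval trees

Balanced (AVL) search trees on the left endpoints, in which every node also stores the largest
right endpoint that occurs in its subtree. -/

/-- A node stores the height of its subtree, the largest right endpoint in its subtree, the left
subtree, the interval `[lo, hi]`, the identifier of that interval, and the right subtree. -/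
inductive ITree (α : Type) where
  | leaf : ITree α
  | node (ht : ℕ) (mx : α) (l : ITree α) (lo hi : α) (id : ℕ) (r : ITree α) : ITree α

namespace ITree

variable {α : Type} [LinearOrder α]

def height : ITree α → Timed ℕ
  | leaf => op 0
  | node ht _ _ _ _ _ _ => op ht

/-- The maximum of `b` and of all right endpoints stored in the tree. -/
def maxWith (b : α) : ITree α → Timed α
  | leaf => op b
  | node _ mx _ _ _ _ _ => op (max mx b)

/-- Allocate a node with given children and compute its two derived fields. -/
def mk (l : ITree α) (lo hi : α) (id : ℕ) (r : ITree α) : Timed (ITree α) := do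
  let hl ← l.height
  let hr ← r.height
  let h ← op (max hl hr)
  let h1 ← op (h + 1)
  let m ← l.maxWith hi
  let mx ← r.maxWith m
  op (node h1 mx l lo hi id r)

/-- Single or double rotation for a left subtree that is too high. -/
def rotateRight (l : ITree α) (lo hi : α) (id : ℕ) (r : ITree α) : Timed (ITree α) :=
  match l with
  | leaf => mk l lo hi id r
  | node _ _ ll llo lhi lid lr => do
      let hll ← ll.height
      let hlr ← lr.height
      let outer ← op (decide (hlr ≤ hll))
      if outer then
        let r1 ← mk lr lo hi id r
        mk ll llo lhi lid r1
      else
        match lr with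
        | leaf => mk l lo hi id r
        | node _ _ ml mlo mhi mid mr => do
            let l1 ← mk ll llo lhi lid ml
            let r1 ← mk mr lo hi id r
            mk l1 mlo mhi mid r1

/-- Single or double rotation for a right subtree that is too high. -/
def rotateLeft (l : ITree α) (lo hi : α) (id : ℕ) (r : ITree α) : Timed (ITree α) :=
  match r with
  | leaf => mk l lo hi id r
  | node _ _ rl rlo rhi rid rr => do
      let hrl ← rl.height
      let hrr ← rr.height
      let outer ← op (decide (hrl ≤ hrr))
      if outer then
        let l1 ← mk l lo hi id rl
        mk l1 rlo rhi rid rr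
      else
        match rl with
        | leaf => mk l lo hi id r
        | node _ _ ml mlo mhi mid mr => do
            let l1 ← mk l lo hi id ml
            let r1 ← mk mr rlo rhi rid rr
            mk l1 mlo mhi mid r1

/-- A node with the given children, rebalanced if the heights differ by more than one. -/
def balance (l : ITree α) (lo hi : α) (id : ℕ) (r : ITree α) : Timed (ITree α) := do
  let hl ← l.height
  let hr ← r.height
  let leftHeavy ← op (decide (hr + 1 < hl))
  if leftHeavy then
    rotateRight l lo hi id r
  else
    let rightHeavy ← op (decide (hl + 1 < hr))
    if rightHeavy then
      rotateLeft l lo hi id r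
    else
      mk l lo hi id r

/-- Insert the interval `[x, y]` with identifier `k`. -/
def insert (x y : α) (k : ℕ) : ITree α → Timed (ITree α)
  | leaf => mk leaf x y k leaf
  | node _ _ l lo hi id r => do
      let goLeft ← op (decide (x < lo))
      if goLeft then
        let l1 ← insert x y k l
        balance l1 lo hi id r
      else
        let r1 ← insert x y k r
        balance l lo hi id r1

/-- Put the identifiers of all stored intervals that intersect `[x, y]` in front of `acc`. -/
def query (x y : α) : ITree α → List ℕ → Timed (List ℕ)
  | leaf, acc => op acc
  | node _ mx l lo hi id r, acc => do
      let allBefore ← op (decide (mx < x))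
      if allBefore then
        pure acc
      else
        let rightAfter ← op (decide (y < lo))
        if rightAfter then
          query x y l acc
        else
          let acc1 ← query x y r acc
          let hit ← op (decide (x ≤ hi))
          if hit then
            let acc2 ← op (id :: acc1)
            query x y l acc2
          else
            query x y l acc1

/-- The list of identifiers of all stored intervals that intersect `[x, y]`. -/
def intersection (t : ITree α) (x y : α) : Timed (List ℕ) := query x y t []

end ITree

/-! ### Supporting line segments

The supporting line segment at an endpoint `t` is kept as a dynamic array `A` of flags (`A[l]` tells
whether an interval of level `l` contains `t`), and a doubly linked list `Q` of all indices `l` with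
`A[l] = false`, in increasing order.  The list node that holds `l` lives in the cell `ptr[l]` of
a second dynamic array (`none` if `l` is not in the list), so that links are indices. -/

/-- The links of a node of the doubly linked list. -/
structure Link where
  prev : Option ℕ
  next : Option ℕ

structure SLS where
  A : DynArray Bool
  ptr : DynArray (Option Link)
  head : Option ℕ
  tail : Option ℕ

namespace SLS

def empty : SLS := ⟨DynArray.empty, DynArray.empty, none, none⟩

/-- Overwrite the `next` link of node `i`, or the head of the list if there is no such node. -/
def setNext (s : SLS) (i v : Option ℕ) : Timed SLS :=
  match i with
  | none => op { s with head := v }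
  | some p => do
      let c ← s.ptr.get p
      match c with
      | some (some k) => do
          let a ← s.ptr.set p (some { k with next := v })
          op { s with ptr := a }
      | _ => pure s

/-- Overwrite the `prev` link of node `i`, or the tail of the list if there is no such node. -/
def setPrev (s : SLS) (i v : Option ℕ) : Timed SLS :=
  match i with
  | none => op { s with tail := v }
  | some p => do
      let c ← s.ptr.get p
      match c with
      | some (some k) => do
          let a ← s.ptr.set p (some { k with prev := v })
          op { s with ptr := a }
      | _ => pure s

/-- Extend `A` by one cell with value `false` and insert its index at the end of `Q`. -/
def grow (s : SLS) : Timed SLS := do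
  let i ← s.A.size
  let a ← s.A.push false
  let p ← s.ptr.push (some ⟨s.tail, none⟩)
  let s1 ← op { s with A := a, ptr := p }
  let s2 ← s1.setNext s.tail (some i)
  op { s2 with tail := some i }

/-- `k`-fold `grow`. -/
def growBy : ℕ → SLS → Timed SLS
  | 0, s => op s
  | k + 1, s => do
      let s1 ← s.grow
      growBy k s1

/-- Delete `l` from `Q`; nothing happens if `l` is not in `Q`. -/
def unlink (s : SLS) (l : ℕ) : Timed SLS := do
  let c ← s.ptr.get l
  match c with
  | some (some k) => do
      let s1 ← s.setNext k.prev k.next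
      let s2 ← s1.setPrev k.next k.prev
      let p ← s2.ptr.set l none
      op { s2 with ptr := p }
  | _ => pure s

/-- Set `A[l]` to `true` and delete `l` from `Q`. -/
def mark (s : SLS) (l : ℕ) : Timed SLS := do
  let a ← s.A.set l true
  let s1 ← op { s with A := a }
  s1.unlink l

/-- `mark` for all entries of a list. -/
def markAll : List ℕ → SLS → Timed SLS
  | [], s => op s
  | l :: ls, s => do
      let s1 ← s.mark l
      markAll ls s1

/-- The height of the supporting line segment: the first entry of `Q`, or the length of `A` if `Q`
is empty (then all flags are set). -/
def height (s : SLS) : Timed ℕ := do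
  let h ← op s.head
  match h with
  | some v => pure v
  | none => s.A.size

end SLS

/-! ### The algorithm -/

/-- Colour of an interval, as far as it has been computed. -/
structure ColorRec where
  level : Option ℕ
  offset : Option ℕ

/-- The data kept between two insertions.  Intervals are identified by their index in the sequence,
endpoints by their index in the array `sls`. -/
structure State (α : Type) where
  /-- interval tree of all intervals -/
  ivals : ITree α
  /-- interval tree of all endpoints, each endpoint `t` being stored as `[t, t]` -/
  ends : ITree α
  /-- table that maps a level to the interval tree of all intervals of that level -/
  table : DynArray (ITree α)
  /-- level and offset of every interval -/
  colors : DynArray ColorRec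
  /-- supporting line segment of every endpoint -/
  sls : DynArray SLS

namespace State

variable {α : Type} [LinearOrder α]

def init : State α := ⟨.leaf, .leaf, .empty, .empty, .empty⟩

/-- Go through a list of intervals; compute the maximum of `h` and of the levels of these intervals,
and put these levels in front of `U`.  An interval whose level is not yet known is skipped. -/
def collectLevels (colors : DynArray ColorRec) :
    List ℕ → ℕ → List ℕ → Timed (ℕ × List ℕ)
  | [], h, U => op (h, U)
  | i :: is, h, U => do
      let c ← colors.get i
      match c with
      | some ⟨some l, _⟩ => do
          let h1 ← op (max h l)
          let U1 ← op (l :: U)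
          collectLevels colors is h1 U1
      | _ => collectLevels colors is h U

/-- The procedure compute-SLS. -/
def computeSLS (s : State α) (t : α) : Timed SLS := do
  let It ← s.ivals.intersection t t
  let hU ← collectLevels s.colors It 0 []
  let k ← op (hU.1 + 1)
  let e ← SLS.growBy k SLS.empty
  SLS.markAll hU.2 e

/-- Make sure that `t` is stored as an endpoint, with its supporting line segment. -/
def addEndpoint (s : State α) (t : α) : Timed (State α) := do
  let found ← s.ends.intersection t t
  let new ← op found.isEmpty
  if new then
    let e ← s.computeSLS t
    let k ← s.sls.size
    let a ← s.sls.push e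
    let tr ← s.ends.insert t t k
    op { s with sls := a, ends := tr }
  else
    pure s

/-- The maximum of `h` and of the heights of the listed supporting line segments. -/
def maxHeight (sls : DynArray SLS) : List ℕ → ℕ → Timed ℕ
  | [], h => op h
  | k :: ks, h => do
      let c ← sls.get k
      match c with
      | some e => do
          let ht ← e.height
          let h1 ← op (max h ht)
          maxHeight sls ks h1
      | none => maxHeight sls ks h

/-- The procedure compute-max-SLS: the endpoints in `[x, y]` and the maximum height there. -/
def computeMaxSLS (s : State α) (x y : α) : Timed (List ℕ × ℕ) := do
  let S ← s.ends.intersection x y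
  let h ← maxHeight s.sls S 0
  op (S, h)

/-- The procedure update-Endpoints: record an interval of level `l` at all listed endpoints. -/
def updateEndpoints (l : ℕ) : List ℕ → DynArray SLS → Timed (DynArray SLS)
  | [], sls => op sls
  | k :: ks, sls => do
      let c ← sls.get k
      match c with
      | some e => do
          let sz ← e.A.size
          let m ← op (l + 1 - sz)
          let e1 ← e.growBy m
          let e2 ← e1.mark l
          let sls1 ← sls.set k e2
          updateEndpoints l ks sls1
      | none => updateEndpoints l ks sls

/-- Append `k` empty interval trees to the table. -/
def growTable : ℕ → DynArray (ITree α) → Timed (DynArray (ITree α))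
  | 0, T => op T
  | k + 1, T => do
      let T1 ← T.push .leaf
      growTable k T1

/-- Go through a list of intervals and find out which of the offsets 1 and 2 are in use. -/
def usedOffsets (colors : DynArray ColorRec) :
    List ℕ → Bool → Bool → Timed (Bool × Bool)
  | [], u1, u2 => op (u1, u2)
  | i :: is, u1, u2 => do
      let c ← colors.get i
      match c with
      | some ⟨_, some o⟩ => do
          let b1 ← op (u1 || o == 1)
          let b2 ← op (u2 || o == 2)
          usedOffsets colors is b1 b2
      | _ => usedOffsets colors is u1 u2

/-- The procedure compute-Offset, for the interval `[x, y]` with index `i` and level `l`. -/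
def computeOffset (s : State α) (x y : α) (i l : ℕ) : Timed (State α) := do
  let sz ← s.table.size
  let m ← op (l + 1 - sz)
  let T ← growTable m s.table
  let c ← T.get l
  match c with
  | some tr => do
      let S ← tr.intersection x y
      let u ← usedOffsets s.colors S false false
      let o ← op (if u.1 then (if u.2 then 3 else 2) else 1)
      let cs ← s.colors.set i ⟨some l, some o⟩
      let tr1 ← tr.insert x y i
      let T1 ← T.set l tr1
      op { s with table := T1, colors := cs }
  | none => pure s

/-- The procedure handle-Insert. -/
def handleInsert (s : State α) (J : NonemptyInterval α) : Timed (State α) := do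
  let i ← s.colors.size
  let tr ← s.ivals.insert J.fst J.snd i
  let cs ← s.colors.push ⟨none, none⟩
  let s1 ← op { s with ivals := tr, colors := cs }
  let s2 ← s1.addEndpoint J.fst
  let s3 ← s2.addEndpoint J.snd
  let Sh ← s3.computeMaxSLS J.fst J.snd
  let cs1 ← s3.colors.set i ⟨some Sh.2, none⟩
  let a ← updateEndpoints Sh.2 Sh.1 s3.sls
  let s4 ← op { s3 with colors := cs1, sls := a }
  s4.computeOffset J.fst J.snd i Sh.2

/-- The colour (level, offset) that the data structure stores for the interval with index `i`. -/
def color (s : State α) (i : ℕ) : Option (ℕ × ℕ) :=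
  match s.colors.elems[i]? with
  | some ⟨some l, some o⟩ => some (l, o)
  | _ => none

end State

/-- Insert the first `n` intervals of the sequence `I`, in order, into the empty data structure. -/
def run {α : Type} [LinearOrder α] (I : ℕ → NonemptyInterval α) : ℕ → Timed (State α)
  | 0 => pure State.init
  | n + 1 => do
      let s ← run I n
      s.handleInsert (I n)

/-! ### Interval graphs and the abstract algorithm KT-SLS -/

/-- Two intervals have a common point. -/
def Meets {α : Type} [LinearOrder α] (J K : NonemptyInterval α) : Prop := ∃ t, t ∈ J ∧ t ∈ K

/-- The interval graph of the first `n` intervals of a sequence. -/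
def intervalGraph {α : Type} [LinearOrder α] (I : ℕ → NonemptyInterval α) (n : ℕ) :
    SimpleGraph (Fin n) where
  Adj i j := i ≠ j ∧ Meets (I i) (I j)
  symm := ⟨fun _ _ h => ⟨h.1.symm, h.2.imp fun _ ht => ht.symm⟩⟩
  loopless := ⟨fun _ h => h.1 rfl⟩

open Classical in
/-- The maximum degree of the interval graph of the first `n` intervals. -/
noncomputable def maxDeg {α : Type} [LinearOrder α] (I : ℕ → NonemptyInterval α) (n : ℕ) : ℕ :=
  (intervalGraph I n).maxDegree

/-- The height at `t` of the supporting line segment when the first `i` intervals are present: the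
least natural number that is not the level of one of these intervals containing `t`. -/
noncomputable def slsHeight {α : Type} [LinearOrder α] (I : ℕ → NonemptyInterval α) (L : ℕ → ℕ)
    (i : ℕ) (t : α) : ℕ :=
  sInf {y : ℕ | ∀ j < i, t ∈ I j → L j ≠ y}

/-- `L` and `o` are the levels and offsets that algorithm KT-SLS computes for the sequence `I`. -/
structure IsKTSLS {α : Type} [LinearOrder α] (I : ℕ → NonemptyInterval α) (L o : ℕ → ℕ) :
    Prop where
  level : ∀ i, IsGreatest {h | ∃ t ∈ I i, h = slsHeight I L i t} (L i)
  offset : ∀ i, IsLeast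
    (({1, 2, 3} : Set ℕ) \ {c | ∃ j < i, Meets (I j) (I i) ∧ L j = L i ∧ o j = c}) (o i)

end IntervalColoring

/-! The colouring works because every interval owns a private point. Let s in I_i attain the maximum
height that defines L(I_i). No earlier interval through s has that level. Heights never decrease in
time and I_i itself occupies its level at s, so every later interval through s gets a strictly
larger level. Hence s lies in no other interval of the same level (`IsLevel.exists_point_notMem`).
If three intervals of one level met a fourth of that level, two of them would lie on the same side
of its private point, and the one reaching farther out would cover the private point of the other
(`IsLevel.not_three`). So one of three offsets is always free. A height h at t is witnessed by at
least h intervals through t, which form a clique together with the new one; thus all levels are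
below ω. Level 0 is an independent set and only uses offset 1, which leaves 1 + 3(ω - 1) colours
(`IsKTSLS.card_colors_le`).

The algorithm maximizes only over stored endpoints. Nothing is lost: all left endpoints are stored,
so moving from t in I_n to the nearest stored point on its left, within I_n, leaves no interval that
contains t, and the height cannot drop (`Params.maxHeight_eq`).

For the running time there are two points. A query for [x, y] in an interval tree visits, apart from
boundary paths of length O(log n), only entries that start between the start of some entry reaching
x and y (`ITree.Balanced.time_query_le`). If [x, y] is inside I_i, each of them meets I_i or the
leftmost-starting entry that meets [x, y], so their number is at most 2(Δ + 1)
(`DegLE.countP_near_le`). Secondly, one insertion may have to extend up to 2(Δ + 1) arrays by up to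
Δ + 1 cells each, which is too much for a worst-case bound. A potential, linear in the numbers of
cells and in the capacities of the arrays, pays for creating cells and for reallocation, so that an
insertion has amortized cost O(log n + Δ + 1) (`Params.handleInsert_spec`). There are at most 2n
endpoints with at most Δ + 1 cells each, so the final potential is O(n(Δ + 1)) (`StateInv.pot_le`).
-/

namespace IntervalColoring

/-! ### Values and costs of sequenced programs -/

namespace Timed

variable {β γ : Type}

@[simp] theorem val_bind (x : Timed β) (f : β → Timed γ) : (x >>= f).val = (f x.val).val := rfl

@[simp] theorem time_bind (x : Timed β) (f : β → Timed γ) :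
    (x >>= f).time = x.time + (f x.val).time := rfl

@[simp] theorem val_pure (x : β) : (pure x : Timed β).val = x := rfl

@[simp] theorem time_pure (x : β) : (pure x : Timed β).time = 0 := rfl

@[simp] theorem val_op (x : β) : (op x).val = x := rfl

@[simp] theorem time_op (x : β) : (op x).time = 1 := rfl

@[simp] theorem time_charge (k : ℕ) : (charge k).time = k := rfl

end Timed

/-! ### AVL trees: invariants, insertion, height -/

namespace ITree

variable {α : Type}

/-- The entries `(lo, hi, id)` of a tree in symmetric order. -/
def entries : ITree α → List (α × α × ℕ)
  | leaf => []
  | node _ _ l lo hi id r => l.entries ++ (lo, hi, id) :: r.entries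

/-- The stored height. -/
def ht : ITree α → ℕ
  | leaf => 0
  | node h _ _ _ _ _ _ => h

@[simp] theorem ht_leaf : (leaf : ITree α).ht = 0 := rfl

@[simp] theorem ht_node (h : ℕ) (m : α) (l : ITree α) (lo hi : α) (id : ℕ) (r : ITree α) :
    (node h m l lo hi id r).ht = h := rfl

@[simp] theorem val_height (t : ITree α) : t.height.val = t.ht := by cases t <;> rfl

@[simp] theorem time_height (t : ITree α) : t.height.time = 1 := by cases t <;> rfl

variable [LinearOrder α]

/-- The AVL condition, with correct derived fields. -/
def Balanced : ITree α → Prop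
  | leaf => True
  | node h m l lo hi id r => h = max l.ht r.ht + 1 ∧ l.ht ≤ r.ht + 1 ∧ r.ht ≤ l.ht + 1 ∧
      (∀ e ∈ l.entries ++ (lo, hi, id) :: r.entries, e.2.1 ≤ m) ∧
      (∃ e ∈ l.entries ++ (lo, hi, id) :: r.entries, e.2.1 = m) ∧ l.Balanced ∧ r.Balanced

/-- The entries are sorted by left endpoint. -/
def Sorted (t : ITree α) : Prop := t.entries.Pairwise fun a b => a.1 ≤ b.1

@[simp] theorem time_maxWith (b : α) (t : ITree α) : (t.maxWith b).time = 1 := by cases t <;> rfl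

/-- Both halves of the description of the stored maximum matter: that it is an upper bound makes
pruned queries correct, that it is attained makes them fast. -/
theorem Balanced.maxWith {t : ITree α} (h : t.Balanced) (b : α) :
    (∀ e ∈ t.entries, e.2.1 ≤ (t.maxWith b).val) ∧ b ≤ (t.maxWith b).val ∧
      ((t.maxWith b).val = b ∨ ∃ e ∈ t.entries, e.2.1 = (t.maxWith b).val) := by
  cases t with
  | leaf => simp [entries, ITree.maxWith]
  | node ht m l lo hi id r =>
    obtain ⟨-, -, -, h1, ⟨e, he, hm⟩, -, -⟩ := h
    simp only [entries, ITree.maxWith, Timed.val_op]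
    refine ⟨fun e he => (h1 e he).trans (le_max_left _ _), le_max_right _ _, ?_⟩
    rcases le_total m b with hb | hb
    · exact Or.inl (max_eq_right hb)
    · exact Or.inr ⟨e, he, by rw [hm, max_eq_left hb]⟩

@[simp] theorem time_mk (l : ITree α) (lo hi : α) (id : ℕ) (r : ITree α) :
    (mk l lo hi id r).time = 7 := by
  simp [mk]

@[simp] theorem ht_mk (l : ITree α) (lo hi : α) (id : ℕ) (r : ITree α) :
    (mk l lo hi id r).val.ht = max l.ht r.ht + 1 := by
  simp [mk]

@[simp] theorem entries_mk (l : ITree α) (lo hi : α) (id : ℕ) (r : ITree α) :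
    (mk l lo hi id r).val.entries = l.entries ++ (lo, hi, id) :: r.entries := by
  simp [mk, entries]

theorem Balanced.mk {l r : ITree α} (hl : l.Balanced) (hr : r.Balanced) (h1 : l.ht ≤ r.ht + 1)
    (h2 : r.ht ≤ l.ht + 1) (lo hi : α) (id : ℕ) : (ITree.mk l lo hi id r).val.Balanced := by
  obtain ⟨a1, a2, a3⟩ := hl.maxWith hi
  obtain ⟨b1, b2, b3⟩ := hr.maxWith (l.maxWith hi).val
  simp only [ITree.mk, Timed.val_bind, val_height, Timed.val_op, Balanced, true_and, h1, h2, hl, hr,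
    and_true, List.mem_append, List.mem_cons]
  constructor
  · rintro e (he | rfl | he)
    · exact (a1 e he).trans b2
    · exact a2.trans b2
    · exact b1 e he
  · rcases b3 with b3 | ⟨e, he, h⟩
    · rw [b3]
      rcases a3 with a3 | ⟨e, he, h⟩
      · exact ⟨(lo, hi, id), by simp, a3.symm⟩
      · exact ⟨e, by simp [he], h⟩
    · exact ⟨e, by simp [he], h⟩

theorem time_balance_le (l : ITree α) (lo hi : α) (id : ℕ) (r : ITree α) :
    (balance l lo hi id r).time ≤ 28 := by
  -- A double rotation reads two heights, makes one comparison and allocates three nodes at cost 7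
  -- each, 24 in all; `balance` itself adds two reads and two comparisons.
  have h1 : (rotateRight l lo hi id r).time ≤ 24 := by
    unfold rotateRight
    split
    · simp
    · simp only [Timed.time_bind, time_height, val_height, Timed.time_op, Timed.val_op,
        decide_eq_true_eq]
      split
      · simp
      · split <;> simp
  have h2 : (rotateLeft l lo hi id r).time ≤ 24 := by
    unfold rotateLeft
    split
    · simp
    · simp only [Timed.time_bind, time_height, val_height, Timed.time_op, Timed.val_op,
        decide_eq_true_eq]
      split
      · simp
      · split <;> simp
  simp only [balance, Timed.time_bind, time_height, val_height, Timed.time_op,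
    Timed.val_op, decide_eq_true_eq]
  split
  · omega
  · simp only [Timed.time_bind, Timed.val_op, Timed.time_op, decide_eq_true_eq]
    split
    · omega
    · simp

theorem entries_balance (l : ITree α) (lo hi : α) (id : ℕ) (r : ITree α) :
    (balance l lo hi id r).val.entries = l.entries ++ (lo, hi, id) :: r.entries := by
  simp only [balance, Timed.val_bind, val_height, Timed.val_op, decide_eq_true_eq]
  split
  · unfold rotateRight
    split
    · simp
    · simp only [Timed.val_bind, val_height, Timed.val_op, decide_eq_true_eq]
      split
      · simp [entries]
      · split <;> simp [entries]
  · simp only [Timed.val_bind, Timed.val_op, decide_eq_true_eq]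
    split
    · unfold rotateLeft
      split
      · simp
      · simp only [Timed.val_bind, val_height, Timed.val_op, decide_eq_true_eq]
        split
        · simp [entries]
        · split <;> simp [entries]
    · simp

theorem Balanced.rotateRight {l r : ITree α} (hl : l.Balanced) (hr : r.Balanced)
    (h : l.ht = r.ht + 2) (lo hi : α) (id : ℕ) :
    (ITree.rotateRight l lo hi id r).val.Balanced ∧
      l.ht ≤ (ITree.rotateRight l lo hi id r).val.ht ∧
      (ITree.rotateRight l lo hi id r).val.ht ≤ l.ht + 1 := by
  unfold ITree.rotateRight
  split
  · simp at h
  · rename_i h' m ll llo lhi lid lr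
    obtain ⟨e1, e2, e3, -, -, b1, b2⟩ := hl
    simp only [ht_node] at h
    simp only [Timed.val_bind, val_height, Timed.val_op, decide_eq_true_eq, ht_node]
    split
    · rename_i hc
      refine ⟨Balanced.mk b1 (Balanced.mk b2 hr ?_ ?_ _ _ _) ?_ ?_ _ _ _, ?_, ?_⟩ <;>
        (try simp only [Timed.val_bind, ht_mk]) <;> omega
    · rename_i hc
      split
      · simp at hc
      · obtain ⟨f1, f2, f3, -, -, c1, c2⟩ := b2
        simp only [ht_node] at *
        simp only [Timed.val_bind]
        refine ⟨Balanced.mk (Balanced.mk b1 c1 ?_ ?_ _ _ _) (Balanced.mk c2 hr ?_ ?_ _ _ _)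
          ?_ ?_ _ _ _, ?_, ?_⟩ <;>
          (try simp only [ht_mk]) <;> omega

theorem Balanced.rotateLeft {l r : ITree α} (hl : l.Balanced) (hr : r.Balanced)
    (h : r.ht = l.ht + 2) (lo hi : α) (id : ℕ) :
    (ITree.rotateLeft l lo hi id r).val.Balanced ∧
      r.ht ≤ (ITree.rotateLeft l lo hi id r).val.ht ∧
      (ITree.rotateLeft l lo hi id r).val.ht ≤ r.ht + 1 := by
  unfold ITree.rotateLeft
  split
  · simp at h
  · rename_i h' m rl rlo rhi rid rr
    obtain ⟨e1, e2, e3, -, -, b1, b2⟩ := hr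
    simp only [ht_node] at h
    simp only [Timed.val_bind, val_height, Timed.val_op, decide_eq_true_eq, ht_node]
    split
    · rename_i hc
      refine ⟨Balanced.mk (Balanced.mk hl b1 ?_ ?_ _ _ _) b2 ?_ ?_ _ _ _, ?_, ?_⟩ <;>
        (try simp only [Timed.val_bind, ht_mk]) <;> omega
    · rename_i hc
      split
      · simp at hc
      · obtain ⟨f1, f2, f3, -, -, c1, c2⟩ := b1
        simp only [ht_node] at *
        simp only [Timed.val_bind]
        refine ⟨Balanced.mk (Balanced.mk hl c1 ?_ ?_ _ _ _) (Balanced.mk c2 b2 ?_ ?_ _ _ _)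
          ?_ ?_ _ _ _, ?_, ?_⟩ <;>
          (try simp only [ht_mk]) <;> omega

/-- The last clause covers the case without rotation. If a rotation happens after an insertion, the
grown subtree was already the higher one, so the old height of the node equals the new height of
that subtree; either way the height of the node does not decrease and grows by at most one. -/
theorem Balanced.balance {l r : ITree α} (hl : l.Balanced) (hr : r.Balanced)
    (h1 : l.ht ≤ r.ht + 2) (h2 : r.ht ≤ l.ht + 2) (lo hi : α) (id : ℕ) :
    (ITree.balance l lo hi id r).val.Balanced ∧
      max l.ht r.ht ≤ (ITree.balance l lo hi id r).val.ht ∧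
      (ITree.balance l lo hi id r).val.ht ≤ max l.ht r.ht + 1 ∧
      (l.ht ≤ r.ht + 1 → r.ht ≤ l.ht + 1 →
        (ITree.balance l lo hi id r).val.ht = max l.ht r.ht + 1) := by
  simp only [ITree.balance, Timed.val_bind, val_height, Timed.val_op, decide_eq_true_eq]
  split
  · obtain ⟨a, b, c⟩ := hl.rotateRight hr (by omega) lo hi id
    exact ⟨a, by omega, by omega, by omega⟩
  · simp only [Timed.val_bind, Timed.val_op, decide_eq_true_eq]
    split
    · obtain ⟨a, b, c⟩ := hl.rotateLeft hr (by omega) lo hi id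
      exact ⟨a, by omega, by omega, by omega⟩
    · exact ⟨hl.mk hr (by omega) (by omega) _ _ _, by simp, by simp, by simp⟩

theorem Balanced.insert {t : ITree α} (ht : t.Balanced) (x y : α) (k : ℕ) :
    (ITree.insert x y k t).val.Balanced ∧ t.ht ≤ (ITree.insert x y k t).val.ht ∧
      (ITree.insert x y k t).val.ht ≤ t.ht + 1 := by
  induction t with
  | leaf =>
    exact ⟨Balanced.mk (l := leaf) (r := leaf) trivial trivial (by simp) (by simp) _ _ _, by simp,
      by simp [ITree.insert]⟩
  | node h m l lo hi id r ihl ihr =>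
    obtain ⟨e1, e2, e3, -, -, b1, b2⟩ := ht
    simp only [ITree.insert, Timed.val_bind, Timed.val_op, decide_eq_true_eq]
    split
    · obtain ⟨c1, c2, c3⟩ := ihl b1
      simp only [Timed.val_bind]
      obtain ⟨d1, d2, d3, d4⟩ := c1.balance b2 (by omega) (by omega) lo hi id
      refine ⟨d1, ?_, ?_⟩ <;> simp only [ht_node] <;> omega
    · obtain ⟨c1, c2, c3⟩ := ihr b2
      simp only [Timed.val_bind]
      obtain ⟨d1, d2, d3, d4⟩ := b1.balance c1 (by omega) (by omega) lo hi id
      refine ⟨d1, ?_, ?_⟩ <;> simp only [ht_node] <;> omega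

theorem perm_entries_insert (t : ITree α) (x y : α) (k : ℕ) :
    (ITree.insert x y k t).val.entries.Perm ((x, y, k) :: t.entries) := by
  induction t with
  | leaf => simp [ITree.insert, entries]
  | node h m l lo hi id r ihl ihr =>
    simp only [ITree.insert, Timed.val_bind, Timed.val_op, decide_eq_true_eq]
    split
    · simp only [Timed.val_bind, entries_balance, entries]
      exact ihl.append_right _
    · simp only [Timed.val_bind, entries_balance, entries]
      refine ((ihr.cons _).append_left _).trans ?_
      refine ((List.Perm.swap _ _ _).append_left _).trans ?_
      exact List.perm_middle

theorem Sorted.insert {t : ITree α} (ht : t.Sorted) (x y : α) (k : ℕ) :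
    (ITree.insert x y k t).val.Sorted := by
  induction t with
  | leaf => simp [ITree.insert, Sorted, entries]
  | node h m l lo hi id r ihl ihr =>
    simp only [Sorted, entries, List.pairwise_append, List.pairwise_cons, List.mem_cons] at ht
    obtain ⟨h1, ⟨h2, h3⟩, h4⟩ := ht
    simp only [ITree.insert, Timed.val_bind, Timed.val_op, decide_eq_true_eq]
    split
    · rename_i hlt
      simp only [Sorted, Timed.val_bind, entries_balance, List.pairwise_append,
        List.pairwise_cons, List.mem_cons]
      refine ⟨ihl h1, ⟨h2, h3⟩, fun a ha b hb => ?_⟩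
      rw [(perm_entries_insert l x y k).mem_iff, List.mem_cons] at ha
      rcases ha with rfl | ha
      · rcases hb with rfl | hb
        · exact hlt.le
        · exact hlt.le.trans (h2 b hb)
      · exact h4 a ha b hb
    · rename_i hlt
      have hlt := not_lt.1 hlt
      simp only [Sorted, Timed.val_bind, entries_balance, List.pairwise_append,
        List.pairwise_cons, List.mem_cons]
      refine ⟨h1, ⟨fun b hb => ?_, ihr h3⟩, fun a ha b hb => ?_⟩
      · rw [(perm_entries_insert r x y k).mem_iff, List.mem_cons] at hb
        rcases hb with rfl | hb
        · exact hlt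
        · exact h2 b hb
      · rw [(perm_entries_insert r x y k).mem_iff, List.mem_cons] at hb
        rcases hb with rfl | rfl | hb
        · exact h4 a ha _ (Or.inl rfl)
        · exact (h4 a ha _ (Or.inl rfl)).trans hlt
        · exact h4 a ha b (Or.inr hb)

theorem Balanced.time_insert_le {t : ITree α} (ht : t.Balanced) (x y : α) (k : ℕ) :
    (ITree.insert x y k t).time ≤ 29 * t.ht + 7 := by
  induction t with
  | leaf => simp [ITree.insert]
  | node h m l lo hi id r ihl ihr =>
    obtain ⟨e1, e2, e3, -, -, b1, b2⟩ := ht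
    simp only [ITree.insert, Timed.time_bind, Timed.val_op, Timed.time_op, decide_eq_true_eq]
    split
    · have := ihl b1
      have := time_balance_le (ITree.insert x y k l).val lo hi id r
      simp only [Timed.time_bind, ht_node]
      omega
    · have := ihr b2
      have := time_balance_le l lo hi id (ITree.insert x y k r).val
      simp only [Timed.time_bind, ht_node]
      omega

/-- Both children of a node of height h have height at least h - 2, so the number of entries plus
one at least doubles whenever the height increases by two. -/
theorem Balanced.two_pow_half_ht_le {t : ITree α} (ht : t.Balanced) :
    2 ^ (t.ht / 2) ≤ t.entries.length + 1 := by
  have key : ∀ k, ∀ t : ITree α, t.Balanced → k ≤ t.ht / 2 → 2 ^ k ≤ t.entries.length + 1 := by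
    intro k
    induction k with
    | zero => intros; simp
    | succ k ih =>
      intro t ht hk
      cases t with
      | leaf => simp at hk
      | node h m l lo hi id r =>
        obtain ⟨e1, e2, e3, -, -, b1, b2⟩ := ht
        simp only [ht_node] at hk
        have h1 := ih l b1 (by omega)
        have h2 := ih r b2 (by omega)
        simp only [entries, List.length_append, List.length_cons, pow_succ]
        omega
  exact key _ t ht le_rfl

theorem Balanced.ht_le {t : ITree α} (ht : t.Balanced) {M : ℕ} (hM : t.entries.length ≤ M) :
    t.ht ≤ 2 * Nat.log 2 (M + 1) + 1 := by
  have := Nat.le_log_of_pow_le one_lt_two (ht.two_pow_half_ht_le.trans (Nat.succ_le_succ hM))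
  simp only [Nat.succ_eq_add_one] at this
  omega

end ITree

end IntervalColoring

namespace IntervalColoring

/-! ### Interval trees: correctness and cost of intersection queries -/

namespace ITree

variable {α : Type} [LinearOrder α]

/-- The identifiers of the entries that meet `[x, y]`. -/
def hits (x y : α) (es : List (α × α × ℕ)) : List ℕ :=
  (es.filter fun e => decide (e.1 ≤ y ∧ x ≤ e.2.1)).map fun e => e.2.2

theorem hits_eq_nil {x y : α} {es : List (α × α × ℕ)} (h : ∀ e ∈ es, ¬ (e.1 ≤ y ∧ x ≤ e.2.1)) :
    hits x y es = [] := by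
  simp only [hits, List.map_eq_nil_iff, List.filter_eq_nil_iff, decide_eq_true_eq]
  exact h

theorem hits_append (x y : α) (es fs : List (α × α × ℕ)) :
    hits x y (es ++ fs) = hits x y es ++ hits x y fs := by
  simp [hits]

theorem mem_hits {x y : α} {es : List (α × α × ℕ)} {k : ℕ} :
    k ∈ hits x y es ↔ ∃ a b, (a, b, k) ∈ es ∧ a ≤ y ∧ x ≤ b := by
  simp [hits, and_assoc]

theorem length_hits (x y : α) (es : List (α × α × ℕ)) :
    (hits x y es).length = es.countP fun e => decide (e.1 ≤ y ∧ x ≤ e.2.1) := by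
  simp [hits, List.countP_eq_length_filter]

theorem Balanced.val_query {t : ITree α} (hb : t.Balanced) (hs : t.Sorted) (x y : α)
    (acc : List ℕ) : (query x y t acc).val = hits x y t.entries ++ acc := by
  induction t generalizing acc with
  | leaf => simp [query, entries, hits]
  | node h m l lo hi id r ihl ihr =>
    obtain ⟨-, -, -, hm, -, b1, b2⟩ := hb
    simp only [Sorted, entries, List.pairwise_append, List.pairwise_cons, List.mem_cons] at hs
    obtain ⟨s1, ⟨s2, s3⟩, s4⟩ := hs
    simp only [query, Timed.val_bind, Timed.val_op, decide_eq_true_eq, entries]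
    split
    · rename_i hx
      rw [hits_eq_nil]
      · rfl
      · rintro e he ⟨-, h2⟩
        exact absurd (h2.trans (hm e he)) (not_le.2 hx)
    simp only [Timed.val_bind, Timed.val_op, decide_eq_true_eq]
    split
    · rename_i hy
      rw [ihl b1 s1, hits_append, hits_eq_nil (es := _ :: _), List.append_nil]
      simp only [List.mem_cons]
      rintro e (rfl | he) ⟨h1, -⟩
      · exact absurd h1 (not_le.2 hy)
      · exact absurd ((s2 e he).trans h1) (not_le.2 hy)
    · rename_i hy
      simp only [Timed.val_bind, Timed.val_op, decide_eq_true_eq]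
      split
      · rename_i hh
        simp only [Timed.val_bind, Timed.val_op]
        rw [ihl b1 s1, ihr b2 s3, hits_append]
        simp [hits, hh, not_lt.1 hy]
      · rename_i hh
        rw [ihl b1 s1, ihr b2 s3, hits_append]
        simp [hits, hh]

theorem Balanced.val_intersection {t : ITree α} (hb : t.Balanced) (hs : t.Sorted) (x y : α) :
    (t.intersection x y).val = hits x y t.entries := by
  rw [intersection, hb.val_query hs, List.append_nil]

theorem time_query_node_of_mx_lt {x y : α} {h m l lo hi id} {r : ITree α} (hm : m < x)
    (acc : List ℕ) : (query x y (node h m l lo hi id r) acc).time = 1 := by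
  simp [query, hm]

theorem time_query_node_of_lt_lo {x y : α} {h m l lo hi id} {r : ITree α} (hy : y < lo)
    (acc : List ℕ) :
    (query x y (node h m l lo hi id r) acc).time ≤ 4 + (query x y l acc).time := by
  simp only [query, Timed.time_bind, Timed.time_op, Timed.val_op, decide_eq_true_eq]
  split
  · simp; omega
  · simp [hy]; omega

/-- A visited node costs at most four steps: three comparisons and one extension of the accumulator.
The accumulator handed to the left call is left unspecified, since the cost bounds below hold for
every accumulator. -/
theorem time_query_node_le (x y : α) (h m) (l : ITree α) (lo hi id) (r : ITree α)
    (acc : List ℕ) : ∃ acc', (query x y (node h m l lo hi id r) acc).time ≤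
      4 + (query x y l acc').time + (query x y r acc).time := by
  by_cases hm : m < x
  · exact ⟨[], by rw [time_query_node_of_mx_lt hm]; omega⟩
  by_cases hy : y < lo
  · exact ⟨acc, (time_query_node_of_lt_lo hy acc).trans (by omega)⟩
  by_cases hx : x ≤ hi
  · exact ⟨id :: (query x y r acc).val, by simp [query, hm, hy, hx]; omega⟩
  · exact ⟨(query x y r acc).val, by simp [query, hm, hy, hx]; omega⟩

theorem time_query_le_length (t : ITree α) (x y : α) (acc : List ℕ) :
    (query x y t acc).time ≤ 4 + 8 * t.entries.length := by
  induction t generalizing acc with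
  | leaf => simp [query, entries]
  | node h m l lo hi id r ihl ihr =>
    obtain ⟨acc', h1⟩ := time_query_node_le x y h m l lo hi id r acc
    have := ihl acc'
    have := ihr acc
    simp only [entries, List.length_append, List.length_cons]
    omega

/-- The stored maximum is attained by an entry, so it is below x and the query stops at the root. -/
theorem Balanced.time_query_of_forall_lt {t : ITree α} (hb : t.Balanced) {x y : α}
    (h : ∀ e ∈ t.entries, e.2.1 < x) (acc : List ℕ) : (query x y t acc).time = 1 := by
  cases t with
  | leaf => simp [query]
  | node ht m l lo hi id r =>
    obtain ⟨-, -, -, -, ⟨e, he, hm⟩, -, -⟩ := hb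
    exact time_query_node_of_mx_lt (hm ▸ h e he) acc

/-- The right boundary of the query. At a node starting after y the search follows one path to the
left; at any other node the whole left subtree starts at or before y and is paid for by the count.
-/
theorem Balanced.time_query_le_countP {t : ITree α} (hb : t.Balanced) (hs : t.Sorted) (x y : α)
    (acc : List ℕ) :
    (query x y t acc).time ≤ 4 + 4 * t.ht + 8 * t.entries.countP (fun e => decide (e.1 ≤ y)) := by
  induction t generalizing acc with
  | leaf => simp [query, entries]
  | node h m l lo hi id r ihl ihr =>
    obtain ⟨e1, e2, e3, -, -, b1, b2⟩ := hb
    simp only [Sorted, entries, List.pairwise_append, List.pairwise_cons, List.mem_cons] at hs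
    obtain ⟨s1, ⟨s2, s3⟩, s4⟩ := hs
    simp only [entries, List.countP_append, List.countP_cons, ht_node]
    by_cases hy : y < lo
    · have h1 := time_query_node_of_lt_lo (x := x) (h := h) (m := m) (l := l) (hi := hi) (id := id)
        (r := r) hy acc
      have h2 := ihl b1 s1 acc
      omega
    · obtain ⟨acc', h1⟩ := time_query_node_le x y h m l lo hi id r acc
      have h2 := ihr b2 s3 acc
      have h3 := time_query_le_length l x y acc'
      have h4 : l.entries.countP (fun e => decide (e.1 ≤ y)) = l.entries.length := by
        rw [List.countP_eq_length]
        intro e he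
        simpa using (s4 e he _ (Or.inl rfl)).trans (not_lt.1 hy)
      rw [if_pos (by simpa using hy)]
      omega

/-- Entry `e` starts not after `y`, and not before some entry from `es` that reaches `x`. -/
def Near (x y : α) (es : List (α × α × ℕ)) (e : α × α × ℕ) : Prop :=
  e.1 ≤ y ∧ ∃ f ∈ es, x ≤ f.2.1 ∧ f.1 ≤ e.1

-- The left boundary of the query. If some entry of the left subtree reaches x, then the root and
-- the whole right subtree are `Near` and pay for themselves, and only the left branch is followed
-- further; otherwise the left call ends at once and only the right branch is followed. The list
-- `es` stays fixed while the induction descends, so that witnesses from the whole tree remain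
-- available in subtrees.
open Classical in
theorem Balanced.time_query_le_of_forall_le {t : ITree α} (hb : t.Balanced) (hs : t.Sorted)
    {x y : α} (hy : ∀ e ∈ t.entries, e.1 ≤ y) {es : List (α × α × ℕ)} (hes : t.entries ⊆ es)
    (acc : List ℕ) :
    (query x y t acc).time ≤ 4 + 8 * t.ht + 8 * t.entries.countP (fun e => Near x y es e) := by
  induction t generalizing acc with
  | leaf => simp [query, entries]
  | node h m l lo hi id r ihl ihr =>
    obtain ⟨e1, e2, e3, -, -, b1, b2⟩ := hb
    simp only [Sorted, entries, List.pairwise_append, List.pairwise_cons, List.mem_cons] at hs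
    obtain ⟨s1, ⟨s2, s3⟩, s4⟩ := hs
    simp only [entries, List.append_subset, List.cons_subset] at hes
    obtain ⟨k1, k2, k3⟩ := hes
    simp only [entries, List.mem_append, List.mem_cons] at hy
    simp only [entries, List.countP_append, List.countP_cons, ht_node]
    obtain ⟨acc', h1⟩ := time_query_node_le x y h m l lo hi id r acc
    have h2 := ihl b1 s1 (fun e he => hy e (Or.inl he)) k1 acc'
    by_cases hl : ∃ f ∈ l.entries, x ≤ f.2.1
    · obtain ⟨f, hf, hx⟩ := hl
      have h3 := time_query_le_length r x y acc
      have h4 : r.entries.countP (fun e => Near x y es e) = r.entries.length := by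
        rw [List.countP_eq_length]
        intro e he
        exact decide_eq_true ⟨hy e (Or.inr (Or.inr he)), f, k1 hf, hx, s4 f hf e (Or.inr he)⟩
      rw [if_pos (decide_eq_true
        ⟨hy _ (Or.inr (Or.inl rfl)), f, k1 hf, hx, s4 f hf _ (Or.inl rfl)⟩)]
      omega
    · push Not at hl
      have h3 := b1.time_query_of_forall_lt (y := y) hl acc'
      have h4 := ihr b2 s3 (fun e he => hy e (Or.inr (Or.inr he))) k3 acc
      omega

-- The search follows a single path until a node whose left subtree has an entry reaching x. There
-- it splits into a left-boundary search (8 per level) on the left and a right-boundary search (4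
-- per level) on the right, whence 12. On the right, the entry found on the left turns "starts at or
-- before y" into `Near`.
open Classical in
theorem Balanced.time_query_le {t : ITree α} (hb : t.Balanced) (hs : t.Sorted)
    (x y : α) {es : List (α × α × ℕ)} (hes : t.entries ⊆ es) (acc : List ℕ) :
    (query x y t acc).time ≤ 4 + 12 * t.ht + 8 * t.entries.countP (fun e => Near x y es e) := by
  induction t generalizing acc with
  | leaf => simp [query, entries]
  | node h m l lo hi id r ihl ihr =>
    obtain ⟨e1, e2, e3, -, -, b1, b2⟩ := hb
    simp only [Sorted, entries, List.pairwise_append, List.pairwise_cons, List.mem_cons] at hs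
    obtain ⟨s1, ⟨s2, s3⟩, s4⟩ := hs
    simp only [entries, List.append_subset, List.cons_subset] at hes
    obtain ⟨k1, k2, k3⟩ := hes
    simp only [entries, List.countP_append, List.countP_cons, ht_node]
    by_cases hy : y < lo
    · have h1 := time_query_node_of_lt_lo (x := x) (h := h) (m := m) (l := l) (hi := hi) (id := id)
        (r := r) hy acc
      have h2 := ihl b1 s1 k1 acc
      omega
    obtain ⟨acc', h1⟩ := time_query_node_le x y h m l lo hi id r acc
    by_cases hl : ∃ f ∈ l.entries, x ≤ f.2.1
    · obtain ⟨f, hf, hx⟩ := hl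
      have h2 := b1.time_query_le_of_forall_le (x := x) s1
        (fun e he => (s4 e he _ (Or.inl rfl)).trans (not_lt.1 hy)) k1 acc'
      have h3 := b2.time_query_le_countP s3 x y acc
      have h4 : r.entries.countP (fun e => decide (e.1 ≤ y)) ≤
          r.entries.countP (fun e => Near x y es e) := by
        refine List.countP_mono_left fun e he h => ?_
        exact decide_eq_true ⟨of_decide_eq_true h, f, k1 hf, hx, s4 f hf e (Or.inr he)⟩
      omega
    · push Not at hl
      have h3 := b1.time_query_of_forall_lt (y := y) hl acc'
      have h4 := ihr b2 s3 k3 acc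
      omega

open Classical in
theorem Balanced.time_intersection_le {t : ITree α} (hb : t.Balanced) (hs : t.Sorted) (x y : α) :
    (t.intersection x y).time ≤
      4 + 12 * t.ht + 8 * t.entries.countP (fun e => Near x y t.entries e) :=
  hb.time_query_le hs x y (List.Subset.refl _) []

end ITree

end IntervalColoring

namespace IntervalColoring

/-! ### Dynamic arrays: doubling and its amortized cost -/

namespace DynArray

variable {β : Type}

/-- The cells in use fit into the block, and the block is at most twice as large as needed. -/
structure WF (a : DynArray β) : Prop where
  size_le : a.elems.size ≤ a.cap
  cap_le : a.cap ≤ 2 * a.elems.size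

theorem WF.empty : (empty : DynArray β).WF := ⟨le_rfl, le_rfl⟩

@[simp] theorem val_size (a : DynArray β) : a.size.val = a.elems.size := rfl

@[simp] theorem time_size (a : DynArray β) : a.size.time = 1 := rfl

@[simp] theorem val_get (a : DynArray β) (i : ℕ) : (a.get i).val = a.elems[i]? := rfl

@[simp] theorem time_get (a : DynArray β) (i : ℕ) : (a.get i).time = 1 := rfl

@[simp] theorem elems_set (a : DynArray β) (i : ℕ) (x : β) :
    (a.set i x).val.elems = a.elems.setIfInBounds i x := rfl

@[simp] theorem cap_set (a : DynArray β) (i : ℕ) (x : β) : (a.set i x).val.cap = a.cap := rfl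

@[simp] theorem time_set (a : DynArray β) (i : ℕ) (x : β) : (a.set i x).time = 1 := rfl

theorem WF.set {a : DynArray β} (h : a.WF) (i : ℕ) (x : β) : (a.set i x).val.WF :=
  ⟨by simpa using h.size_le, by simpa using h.cap_le⟩

@[simp] theorem elems_push (a : DynArray β) (x : β) : (a.push x).val.elems = a.elems.push x := by
  simp only [push, Timed.val_bind, Timed.val_op, decide_eq_true_eq]
  split <;> simp

theorem cap_push (a : DynArray β) (x : β) :
    (a.push x).val.cap = if a.cap ≤ a.elems.size then 2 * a.cap + 1 else a.cap := by
  simp only [push, Timed.val_bind, Timed.val_op, decide_eq_true_eq]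
  split <;> simp

theorem time_push (a : DynArray β) (x : β) :
    (a.push x).time = if a.cap ≤ a.elems.size then 2 * a.cap + 1 + a.elems.size + 3 else 2 := by
  simp only [push, Timed.time_bind, Timed.val_op, decide_eq_true_eq]
  split
  · simp; omega
  · simp

theorem WF.push {a : DynArray β} (h : a.WF) (x : β) : (a.push x).val.WF := by
  obtain ⟨h1, h2⟩ := h
  constructor <;> rw [cap_push, elems_push, Array.size_push] <;> split <;> omega

/-- Amortized cost of `push`: reallocation is paid for by the growth of the capacity. -/
theorem WF.time_push_le {a : DynArray β} (h : a.WF) (x : β) :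
    (a.push x).time + 3 * a.cap ≤ 3 * (a.push x).val.cap + 3 := by
  obtain ⟨h1, h2⟩ := h
  rw [cap_push, time_push]
  split <;> omega

end DynArray

/-! ### Supporting line segments: the linked list of free levels -/

namespace SLS

/-- `x` comes after position `i`, where `none` is the position in front of all numbers. -/
def After (i : Option ℕ) (x : ℕ) : Prop := ∀ p, i = some p → p < x

/-- `x` comes before position `i`, where `none` is the position behind all numbers. -/
def Before (i : Option ℕ) (x : ℕ) : Prop := ∀ p, i = some p → x < p

/-- `v` is the first element of `F` after position `i`. -/
def IsNext (F : ℕ → Prop) (i v : Option ℕ) : Prop :=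
  (∀ w, v = some w → F w ∧ After i w) ∧ ∀ x, F x → After i x → ∃ w, v = some w ∧ w ≤ x

/-- `v` is the last element of `F` before position `i`. -/
def IsPrev (F : ℕ → Prop) (i v : Option ℕ) : Prop :=
  (∀ w, v = some w → F w ∧ Before i w) ∧ ∀ x, F x → Before i x → ∃ w, v = some w ∧ x ≤ w

/-- Only the predecessor p of l changes its successor, namely to the successor q of l. Since `none`
counts as a position, the head pointer and the inner links obey the same rule. -/
theorem IsNext.erase {F : ℕ → Prop} {i p q v : Option ℕ} {l : ℕ} (hv : IsNext F i v) (hl : F l)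
    (hp : IsPrev F (some l) p) (hq : IsNext F (some l) q) (hi : ∀ a, i = some a → F a ∧ a ≠ l) :
    IsNext (fun x => F x ∧ x ≠ l) i (if p = i then q else v) := by
  unfold IsNext IsPrev After Before at *
  obtain ⟨p1, p2⟩ := hp
  obtain ⟨q1, q2⟩ := hq
  obtain ⟨v1, v2⟩ := hv
  rcases i with _ | a <;> rcases p with _ | p <;> rcases q with _ | q <;> rcases v with _ | v <;>
    simp at * <;> grind

theorem IsPrev.erase {F : ℕ → Prop} {i p q v : Option ℕ} {l : ℕ} (hv : IsPrev F i v) (hl : F l)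
    (hp : IsPrev F (some l) p) (hq : IsNext F (some l) q) (hi : ∀ a, i = some a → F a ∧ a ≠ l) :
    IsPrev (fun x => F x ∧ x ≠ l) i (if q = i then p else v) := by
  unfold IsNext IsPrev After Before at *
  obtain ⟨p1, p2⟩ := hp
  obtain ⟨q1, q2⟩ := hq
  obtain ⟨v1, v2⟩ := hv
  rcases i with _ | a <;> rcases p with _ | p <;> rcases q with _ | q <;> rcases v with _ | v <;>
    simp at * <;> grind

theorem IsNext.snoc {F : ℕ → Prop} {i t v : Option ℕ} {n : ℕ} (hn : ∀ x, F x → x < n)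
    (ht : IsPrev F none t) (hi : ∀ a, i = some a → F a) (hv : IsNext F i v) :
    IsNext (fun x => F x ∨ x = n) i (if t = i then some n else v) := by
  unfold IsNext IsPrev After Before at *
  obtain ⟨p1, p2⟩ := ht
  obtain ⟨v1, v2⟩ := hv
  rcases i with _ | a <;> rcases t with _ | p <;> rcases v with _ | v <;>
    simp at * <;> grind

/-- The position must be an actual element: for `none`, which describes the tail pointer, the
predecessor becomes the appended n. -/
theorem IsPrev.snoc {F : ℕ → Prop} {i v : Option ℕ} {n : ℕ} (hn : ∀ x, F x → x < n)
    (hi : ∃ a, i = some a ∧ F a) (hv : IsPrev F i v) : IsPrev (fun x => F x ∨ x = n) i v := by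
  unfold IsPrev Before at *
  obtain ⟨a, rfl, ha⟩ := hi
  obtain ⟨v1, v2⟩ := hv
  have := hn a ha
  grind

/-- `l` is flagged as occupied. -/
def Marked (s : SLS) (l : ℕ) : Prop := s.A.elems[l]? = some true

/-- `l` is flagged as free. -/
def Free (s : SLS) (l : ℕ) : Prop := s.A.elems[l]? = some false

/-- The linked list consists of the free indices in increasing order. -/
structure Valid (s : SLS) : Prop where
  wf_A : s.A.WF
  wf_ptr : s.ptr.WF
  size_eq : s.ptr.elems.size = s.A.elems.size
  head : IsNext s.Free none s.head
  tail : IsPrev s.Free none s.tail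
  link : ∀ l k, s.ptr.elems[l]? = some (some k) →
    s.Free l ∧ IsPrev s.Free (some l) k.prev ∧ IsNext s.Free (some l) k.next
  ptr_of_free : ∀ l, s.Free l → ∃ k, s.ptr.elems[l]? = some (some k)

theorem Valid.empty : SLS.empty.Valid := by
  refine ⟨.empty, .empty, rfl, ?_, ?_, ?_, ?_⟩ <;>
    simp [SLS.empty, DynArray.empty, Free, IsNext, IsPrev]

theorem setNext_spec (s : SLS) (i v : Option ℕ) :
    (s.setNext i v).val.A = s.A ∧ (s.setNext i v).val.tail = s.tail ∧
    (s.setNext i v).val.head = (if i = none then v else s.head) ∧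
    (s.setNext i v).val.ptr.cap = s.ptr.cap ∧
    (s.setNext i v).val.ptr.elems.size = s.ptr.elems.size ∧
    (∀ j : ℕ, (s.setNext i v).val.ptr.elems[j]? = s.ptr.elems[j]?.map
      fun c => c.map fun k => if i = some j then ⟨k.prev, v⟩ else k) ∧
    (s.setNext i v).time ≤ 3 := by
  unfold setNext
  split
  · simp
  · rename_i p
    simp only [Timed.val_bind, DynArray.val_get, Timed.time_bind, DynArray.time_get]
    split
    · rename_i k hk
      simp only [Timed.val_bind, Timed.val_op, DynArray.cap_set, DynArray.elems_set,
        Array.size_setIfInBounds, Timed.time_bind, DynArray.time_set, Timed.time_op]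
      refine ⟨trivial, trivial, by simp, trivial, trivial, fun j => ?_, by omega⟩
      rw [Array.getElem?_setIfInBounds]
      split
      · subst j
        rw [hk]
        have := (Array.getElem?_eq_some_iff.1 hk).1
        simp [this]
      · rename_i h
        simp [h]
    · rename_i hk
      refine ⟨rfl, rfl, by simp, rfl, rfl, fun j => ?_, by simp⟩
      simp only [Timed.val_pure, Option.some.injEq]
      rcases hj : s.ptr.elems[j]? with _ | _ | k
      · simp
      · simp
      · have : p ≠ j := by rintro rfl; exact hk _ hj
        simp [this]

theorem setPrev_spec (s : SLS) (i v : Option ℕ) :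
    (s.setPrev i v).val.A = s.A ∧ (s.setPrev i v).val.head = s.head ∧
    (s.setPrev i v).val.tail = (if i = none then v else s.tail) ∧
    (s.setPrev i v).val.ptr.cap = s.ptr.cap ∧
    (s.setPrev i v).val.ptr.elems.size = s.ptr.elems.size ∧
    (∀ j : ℕ, (s.setPrev i v).val.ptr.elems[j]? = s.ptr.elems[j]?.map
      fun c => c.map fun k => if i = some j then ⟨v, k.next⟩ else k) ∧
    (s.setPrev i v).time ≤ 3 := by
  unfold setPrev
  split
  · simp
  · rename_i p
    simp only [Timed.val_bind, DynArray.val_get, Timed.time_bind, DynArray.time_get]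
    split
    · rename_i k hk
      simp only [Timed.val_bind, Timed.val_op, DynArray.cap_set, DynArray.elems_set,
        Array.size_setIfInBounds, Timed.time_bind, DynArray.time_set, Timed.time_op]
      refine ⟨trivial, trivial, by simp, trivial, trivial, fun j => ?_, by omega⟩
      rw [Array.getElem?_setIfInBounds]
      split
      · subst j
        rw [hk]
        have := (Array.getElem?_eq_some_iff.1 hk).1
        simp [this]
      · rename_i h
        simp [h]
    · rename_i hk
      refine ⟨rfl, rfl, by simp, rfl, rfl, fun j => ?_, by simp⟩
      simp only [Timed.val_pure, Option.some.injEq]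
      rcases hj : s.ptr.elems[j]? with _ | _ | k
      · simp
      · simp
      · have : p ≠ j := by rintro rfl; exact hk _ hj
        simp [this]

/-- The part of the amortized cost that is paid for by the growth of the two arrays. -/
def pot (s : SLS) : ℕ := 12 * s.A.elems.size + 3 * s.A.cap + 3 * s.ptr.cap

theorem Valid.pot_le {s : SLS} (h : s.Valid) : s.pot ≤ 24 * s.A.elems.size := by
  have h1 := h.wf_A.cap_le
  have h2 := h.wf_ptr.cap_le
  rw [h.size_eq] at h2
  unfold pot
  omega

theorem Valid.grow {s : SLS} (h : s.Valid) :
    s.grow.val.Valid ∧ s.grow.val.A.elems = s.A.elems.push false ∧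
      s.grow.time + s.pot ≤ s.grow.val.pot := by
  set n := s.A.elems.size with hn
  set s1 : SLS := { s with
    A := (s.A.push false).val, ptr := (s.ptr.push (some ⟨s.tail, none⟩)).val }
  have h1A : s1.A = (s.A.push false).val := rfl
  have h1p : s1.ptr = (s.ptr.push (some ⟨s.tail, none⟩)).val := rfl
  obtain ⟨e1, e2, e3, e4, e5, e6, e7⟩ := s1.setNext_spec s.tail (some n)
  have hv : s.grow.val = { (s1.setNext s.tail (some n)).val with tail := some n } := rfl
  have ht : s.grow.time = 1 + ((s.A.push false).time + ((s.ptr.push (some ⟨s.tail, none⟩)).time +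
    (1 + ((s1.setNext s.tail (some n)).time + 1)))) := rfl
  have hA : s.grow.val.A.elems = s.A.elems.push false := by rw [hv]; simp [e1, h1A]
  have hlt : ∀ x, s.Free x → x < n := fun x hx => (Array.getElem?_eq_some_iff.1 hx).1
  have hF : s.grow.val.Free = fun x => s.Free x ∨ x = n := by
    funext x
    simp only [Free, hA, Array.getElem?_push, eq_iff_iff, ← hn]
    by_cases hx : x = n
    · simp [hx]
    · simp [hx]
  have hptr : ∀ j : ℕ, s.grow.val.ptr.elems[j]? =
      if j = n then some (some ⟨s.tail, none⟩) else s.ptr.elems[j]?.map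
        fun c => c.map fun k => if s.tail = some j then ⟨k.prev, some n⟩ else k := by
    intro j
    rw [hv]
    simp only [e6, h1p, DynArray.elems_push, Array.getElem?_push, h.size_eq, ← hn]
    by_cases hj : j = n
    · have : s.tail ≠ some j := fun ht => by
        have := hlt j (h.tail.1 j ht).1
        omega
      simp [hj] at this ⊢
      simp [this]
    · simp [hj]
  refine ⟨⟨?_, ?_, ?_, ?_, ?_, ?_, ?_⟩, hA, ?_⟩
  · rw [hv]; simpa [e1] using h.wf_A.push false
  · have := h.wf_ptr.push (some ⟨s.tail, none⟩)
    rw [hv]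
    exact ⟨by simpa [e4, e5, h1p] using this.size_le, by simpa [e4, e5, h1p] using this.cap_le⟩
  · rw [hA, hv]; simp [e5, h1p, h.size_eq]
  · rw [hF, hv]
    simp only [e3]
    exact h.head.snoc hlt h.tail (by simp)
  · rw [hF, hv]
    simp only [IsPrev, Before]
    simp only [Option.some.injEq, reduceCtorEq, IsEmpty.forall_iff, implies_true, and_true,
      forall_eq', or_true, true_and, exists_eq_left']
    rintro x (hx | rfl)
    · exact fun _ => (hlt x hx).le
    · simp
  · intro l k hk
    rw [hptr] at hk
    rw [hF]
    split at hk
    · subst l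
      simp only [Option.some.injEq] at hk
      subst hk
      refine ⟨Or.inr rfl, ?_, ?_⟩
      · have := h.tail
        unfold IsPrev Before at *
        grind
      · unfold IsNext After
        grind
    · simp only [Option.map_eq_some_iff] at hk
      obtain ⟨c, hc, k', rfl, hk'⟩ := hk
      obtain ⟨f, l1, l2⟩ := h.link l k' hc
      have l3 := l1.snoc hlt ⟨l, rfl, f⟩
      have l4 := l2.snoc hlt h.tail (by rintro a ⟨⟩; exact f)
      refine ⟨Or.inl f, ?_⟩
      split at hk' <;> subst hk' <;> rename_i hc
      · rw [if_pos hc] at l4; exact ⟨l3, l4⟩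
      · rw [if_neg hc] at l4; exact ⟨l3, l4⟩
  · intro l hl
    rw [hptr]
    rw [hF] at hl
    split
    · exact ⟨_, rfl⟩
    · obtain ⟨k, hk⟩ := h.ptr_of_free l (by tauto)
      simp [hk]
  -- The cost not paid by growing capacities is 1 for the size, 3 for each of the two pushes, 1 for
  -- the record, at most 3 for `setNext` and 1 for the tail. This is the weight 12 of a cell in
  -- `pot`.
  · have t1 := h.wf_A.time_push_le false
    have t2 := h.wf_ptr.time_push_le (some ⟨s.tail, none⟩)
    have c1 : s.grow.val.A.cap = (s.A.push false).val.cap := by rw [hv]; simp [e1, h1A]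
    have c2 : s.grow.val.ptr.cap = (s.ptr.push (some ⟨s.tail, none⟩)).val.cap := by
      rw [hv]; simp [e4, h1p]
    simp only [pot, hA, c1, c2, ht, Array.size_push]
    omega

theorem Valid.growBy {s : SLS} (h : s.Valid) (k : ℕ) :
    (growBy k s).val.Valid ∧ (growBy k s).val.A.elems.size = s.A.elems.size + k ∧
      (∀ l, (growBy k s).val.Marked l ↔ s.Marked l) ∧
      (growBy k s).time + s.pot ≤ (growBy k s).val.pot + 1 := by
  induction k generalizing s with
  | zero => exact ⟨h, rfl, fun l => Iff.rfl, by simp [SLS.growBy]; omega⟩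
  | succ k ih =>
    obtain ⟨h1, h2, h3⟩ := h.grow
    obtain ⟨i1, i2, i3, i4⟩ := ih h1
    simp only [SLS.growBy, Timed.val_bind, Timed.time_bind]
    refine ⟨i1, by rw [i2, h2, Array.size_push]; omega, fun l => ?_, by omega⟩
    rw [i3]
    simp only [Marked, h2, Array.getElem?_push]
    split
    · subst l; simp
    · rfl

theorem Valid.mark {s : SLS} (h : s.Valid) {l : ℕ} (hl : l < s.A.elems.size) :
    (s.mark l).val.Valid ∧ (s.mark l).val.A.elems.size = s.A.elems.size ∧
      (∀ j, (s.mark l).val.Marked j ↔ s.Marked j ∨ j = l) ∧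
      (s.mark l).val.pot = s.pot ∧ (s.mark l).time ≤ 11 := by
  -- In this intermediate state the flag is set while the list may still contain l, so `Valid` can
  -- fail; it is recovered only after `unlink`.
  set s1 : SLS := { s with A := (s.A.set l true).val }
  have hv : (s.mark l).val = (s1.unlink l).val := rfl
  have ht : (s.mark l).time = 1 + (1 + (s1.unlink l).time) := rfl
  suffices H : (s1.unlink l).val.A = s1.A ∧ (s1.unlink l).val.ptr.cap = s1.ptr.cap ∧
      (s1.unlink l).val.Valid ∧ (s1.unlink l).time ≤ 9 by
    obtain ⟨a1, a2, a3, a4⟩ := H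
    refine ⟨hv ▸ a3, by rw [hv, a1]; simp [s1], fun j => ?_, ?_, by omega⟩
    · simp only [Marked, hv, a1, s1, DynArray.elems_set, Array.getElem?_setIfInBounds]
      by_cases hj : l = j
      · subst hj; simp [hl]
      · simp [hj, Ne.symm hj]
    · simp [pot, hv, a1, a2, s1]
  have hF : s1.Free = fun x => s.Free x ∧ x ≠ l := by
    funext j
    simp only [Free, s1, DynArray.elems_set, Array.getElem?_setIfInBounds, eq_iff_iff]
    by_cases hj : l = j
    · subst hj; simp [hl]
    · simp [hj, Ne.symm hj]
  have hwf : s1.A.WF := h.wf_A.set l true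
  have hsz : s1.A.elems.size = s.A.elems.size := by simp [s1]
  simp only [unlink, Timed.val_bind, DynArray.val_get, Timed.time_bind, DynArray.time_get]
  split
  · rename_i k hk
    obtain ⟨fl, hp, hq⟩ := h.link l k hk
    obtain ⟨e1, e2, e3, e4, e5, e6, e7⟩ := s1.setNext_spec k.prev k.next
    generalize s1.setNext k.prev k.next = s2 at *
    obtain ⟨f1, f2, f3, f4, f5, f6, f7⟩ := s2.val.setPrev_spec k.next k.prev
    generalize hs3 : s2.val.setPrev k.next k.prev = s3 at *
    simp only [Timed.val_bind, Timed.val_op, Timed.time_bind, DynArray.time_set, Timed.time_op,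
      DynArray.cap_set, hs3]
    have hA : s3.val.A = s1.A := f1.trans e1
    have hFr : ∀ (p : DynArray (Option Link)), SLS.Free { s3.val with ptr := p } =
        fun x => s.Free x ∧ x ≠ l := by
      intro p
      rw [← hF]
      unfold Free
      rw [hA]
    -- The joint effect of the two link updates and of clearing cell l, in exactly the form produced
    -- by `IsNext.erase` and `IsPrev.erase`.
    have hptr : ∀ j : ℕ, (s3.val.ptr.elems.setIfInBounds l none)[j]? =
        if j = l then some none else s.ptr.elems[j]?.map fun c => c.map fun m =>
          ⟨if k.next = some j then k.prev else m.prev,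
            if k.prev = some j then k.next else m.next⟩ := by
      intro j
      rw [Array.getElem?_setIfInBounds]
      by_cases hj : l = j
      · subst hj
        have : l < s3.val.ptr.elems.size := by
          rw [f5, e5]; exact h.size_eq ▸ hl
        simp [this]
      · rw [if_neg hj, if_neg (Ne.symm hj), f6, e6]
        simp only [Option.map_map]
        congr 1
        funext c
        simp only [Function.comp, Option.map_map]
        congr 1
        funext m
        simp only [Function.comp]
        split <;> split <;> simp_all
    refine ⟨hA, f4.trans e4, ⟨?_, ?_, ?_, ?_, ?_, ?_, ?_⟩, by omega⟩
    · exact hA ▸ hwf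
    · have h1 := h.wf_ptr
      constructor
      · simpa [f4, e4, f5, e5] using h1.size_le
      · simpa [f4, e4, f5, e5] using h1.cap_le
    · simp only [DynArray.elems_set, Array.size_setIfInBounds, f5, e5, hA, hsz]
      exact h.size_eq
    · rw [hFr]
      simp only [f2, e3]
      exact h.head.erase fl hp hq (by simp)
    · rw [hFr]
      simp only [f3, e2]
      exact h.tail.erase fl hp hq (by simp)
    · intro j m hm
      rw [hFr]
      simp only [DynArray.elems_set, hptr] at hm
      split at hm
      · simp at hm
      · rename_i hj
        simp only [Option.map_eq_some_iff] at hm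
        obtain ⟨c, hc, m', rfl, rfl⟩ := hm
        obtain ⟨g1, g2, g3⟩ := h.link j m' hc
        have hi : ∀ a, some j = some a → s.Free a ∧ a ≠ l := by
          rintro a ⟨⟩; exact ⟨g1, hj⟩
        exact ⟨⟨g1, hj⟩, g2.erase fl hp hq hi, g3.erase fl hp hq hi⟩
    · intro j hj
      rw [hFr] at hj
      simp only [DynArray.elems_set, hptr, if_neg hj.2]
      obtain ⟨m, hm⟩ := h.ptr_of_free j hj.1
      simp [hm]
  -- Without a list node, l was not free before, so setting its flag leaves the set of free levels
  -- unchanged.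
  · rename_i hk
    have hF' : s1.Free = s.Free := by
      rw [hF]
      funext j
      refine propext ⟨And.left, fun hj => ⟨hj, ?_⟩⟩
      rintro rfl
      obtain ⟨m, hm⟩ := h.ptr_of_free j hj
      exact hk m hm
    simp only [Timed.val_pure, Timed.time_pure]
    refine ⟨trivial, trivial, ⟨hwf, h.wf_ptr, by rw [hsz]; exact h.size_eq, ?_, ?_, ?_, ?_⟩,
      by omega⟩ <;>
      rw [hF']
    exacts [h.head, h.tail, h.link, h.ptr_of_free]

theorem Valid.markAll {s : SLS} (h : s.Valid) (ls : List ℕ) (hl : ∀ l ∈ ls, l < s.A.elems.size) :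
    (markAll ls s).val.Valid ∧ (markAll ls s).val.A.elems.size = s.A.elems.size ∧
      (∀ j, (markAll ls s).val.Marked j ↔ s.Marked j ∨ j ∈ ls) ∧
      (markAll ls s).val.pot = s.pot ∧ (markAll ls s).time ≤ 11 * ls.length + 1 := by
  induction ls generalizing s with
  | nil => exact ⟨h, rfl, fun l => by simp [SLS.markAll], rfl, by simp [SLS.markAll]⟩
  | cons l ls ih =>
    simp only [List.mem_cons, forall_eq_or_imp] at hl
    obtain ⟨h1, h2, h3, h4, h5⟩ := h.mark hl.1
    obtain ⟨i1, i2, i3, i4, i5⟩ := ih h1 (by simpa [h2] using hl.2)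
    simp only [SLS.markAll, Timed.val_bind, Timed.time_bind, List.length_cons]
    refine ⟨i1, i2.trans h2, fun j => ?_, i4.trans h4, by omega⟩
    rw [i3, h3, List.mem_cons, or_assoc]

@[simp] theorem time_height_le (s : SLS) : s.height.time ≤ 2 := by
  simp only [height, Timed.time_bind, Timed.time_op, Timed.val_op]
  split <;> simp

theorem Valid.height {s : SLS} (h : s.Valid) :
    (∀ y < s.height.val, s.Marked y) ∧ ¬ s.Marked s.height.val := by
  have hb : ∀ y < s.A.elems.size, ¬ s.Free y → s.Marked y := by
    intro y hy hf
    simp only [Free, Marked, Array.getElem?_eq_getElem hy, Option.some.injEq] at *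
    simpa using hf
  have hn := h.head
  unfold IsNext After at hn
  simp only [SLS.height, Timed.val_bind, Timed.val_op]
  split
  · rename_i v hv
    rw [hv] at hn
    have hf := (hn.1 v rfl).1
    have := (Array.getElem?_eq_some_iff.1 hf).1
    refine ⟨fun y hy => hb y (hy.trans this) fun hc => ?_, ?_⟩
    · obtain ⟨w, hw, h⟩ := hn.2 y hc (by simp)
      simp only [Option.some.injEq] at hw
      simp only [Timed.val_pure] at hy
      omega
    · simp only [Timed.val_pure]
      intro hm
      simp [Free, Marked] at hf hm
      simp [hf] at hm
  · rename_i hv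
    rw [hv] at hn
    simp only [DynArray.val_size]
    refine ⟨fun y hy => hb y hy fun hc => ?_, by simp [Marked]⟩
    obtain ⟨w, hw, -⟩ := hn.2 y hc (by simp)
    simp at hw

end SLS

end IntervalColoring

namespace IntervalColoring

/-! ### The abstract algorithm KT-SLS: existence, properness, number of colours -/

variable {α : Type} [LinearOrder α]

theorem meets_iff {J K : NonemptyInterval α} : Meets J K ↔ J.fst ≤ K.snd ∧ K.fst ≤ J.snd := by
  constructor
  · rintro ⟨t, h1, h2⟩
    exact ⟨h1.1.trans h2.2, h2.1.trans h1.2⟩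
  · rintro ⟨h1, h2⟩
    exact ⟨max J.fst K.fst, ⟨le_max_left _ _, max_le J.fst_le_snd h2⟩,
      ⟨le_max_right _ _, max_le h1 K.fst_le_snd⟩⟩

theorem Meets.symm {J K : NonemptyInterval α} (h : Meets J K) : Meets K J :=
  h.imp fun _ ht => ht.symm

theorem Meets.refl (J : NonemptyInterval α) : Meets J J :=
  ⟨J.fst, ⟨le_rfl, J.fst_le_snd⟩, ⟨le_rfl, J.fst_le_snd⟩⟩

variable {I : ℕ → NonemptyInterval α} {L o : ℕ → ℕ}

theorem exists_of_lt_slsHeight {i y : ℕ} {t : α} (h : y < slsHeight I L i t) :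
    ∃ j < i, t ∈ I j ∧ L j = y := by
  have := Nat.notMem_of_lt_sInf h
  simpa only [Set.mem_ofPred_eq, not_forall, ne_eq, not_not, exists_prop] using this

theorem ne_slsHeight {i j : ℕ} {t : α} (hj : j < i) (ht : t ∈ I j) : L j ≠ slsHeight I L i t := by
  -- One more than all levels so far is admissible, so the infimum is a genuine minimum and not the
  -- default value 0 of the empty set.
  have hne : {y : ℕ | ∀ j < i, t ∈ I j → L j ≠ y}.Nonempty := by
    refine ⟨(Finset.range i).sup L + 1, fun j hj _ => ?_⟩
    have := Finset.le_sup (f := L) (Finset.mem_range.2 hj)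
    omega
  exact Nat.sInf_mem hne j hj ht

theorem slsHeight_eq {i h : ℕ} {t : α} (h1 : ∀ y < h, ∃ j < i, t ∈ I j ∧ L j = y)
    (h2 : ∀ j < i, t ∈ I j → L j ≠ h) : slsHeight I L i t = h := by
  refine le_antisymm (Nat.sInf_le h2) (not_lt.1 fun hlt => ?_)
  obtain ⟨j, hj, ht, e⟩ := h1 _ hlt
  exact ne_slsHeight hj ht e

/-- Every level below the first height is occupied by an interval that also counts for the second
one. This serves both the passage of time and a change of the point. -/
theorem slsHeight_le_slsHeight {i i' : ℕ} {t t' : α}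
    (h : ∀ j < i, t ∈ I j → j < i' ∧ t' ∈ I j) : slsHeight I L i t ≤ slsHeight I L i' t' := by
  by_contra! hlt
  obtain ⟨j, hj, ht, e⟩ := exists_of_lt_slsHeight hlt
  obtain ⟨hj', ht'⟩ := h j hj ht
  exact ne_slsHeight hj' ht' e

open Classical in
theorem slsHeight_le_card (i : ℕ) (t : α) :
    slsHeight I L i t ≤ ((Finset.range i).filter fun j => t ∈ I j).card := by
  have : Finset.range (slsHeight I L i t) ⊆
      ((Finset.range i).filter fun j => t ∈ I j).image L := by
    intro y hy
    obtain ⟨j, hj, ht, e⟩ := exists_of_lt_slsHeight (Finset.mem_range.1 hy)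
    exact Finset.mem_image.2 ⟨j, by simp [hj, ht], e⟩
  simpa using (Finset.card_le_card this).trans Finset.card_image_le

/-- The levels are those of algorithm KT-SLS. -/
def IsLevel (I : ℕ → NonemptyInterval α) (L : ℕ → ℕ) : Prop :=
  ∀ i, IsGreatest {h | ∃ t ∈ I i, h = slsHeight I L i t} (L i)

/-- Every interval has a point that lies in no other interval of the same level. -/
theorem IsLevel.exists_point_notMem (hL : IsLevel I L) (i : ℕ) :
    ∃ s ∈ I i, ∀ j, j ≠ i → L j = L i → s ∉ I j := by
  -- The witness is a point where the maximum in the definition of the level is attained. A later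
  -- interval through s has level at least the height of s at its own time, which is at least L i by
  -- monotonicity and differs from L i because I i passes through s.
  obtain ⟨⟨s, hs, e⟩, -⟩ := hL i
  refine ⟨s, hs, fun j hji hl hsj => ?_⟩
  rcases lt_or_gt_of_ne hji with h | h
  · exact ne_slsHeight h hsj (hl.trans e)
  · have h1 : slsHeight I L i s ≤ slsHeight I L j s :=
      slsHeight_le_slsHeight fun k hk hs => ⟨hk.trans h, hs⟩
    have h2 : L i ≠ slsHeight I L j s := ne_slsHeight h hs
    have h3 : slsHeight I L j s ≤ L j := (hL j).2 ⟨s, hsj, rfl⟩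
    omega

/-- At most two intervals of the level of `I i` meet `I i`. -/
theorem IsLevel.not_three (hL : IsLevel I L) {i : ℕ} {x : Fin 3 → ℕ} (hx : Function.Injective x)
    (hi : ∀ k, x k ≠ i) (hl : ∀ k, L (x k) = L i) (hm : ∀ k, Meets (I (x k)) (I i)) : False := by
  choose s hs hp using hL.exists_point_notMem
  -- Two intervals to the right of the private point of I i, the k-th ending first: the private
  -- point of the k-th lies beyond the right end of I i, and the m-th, which meets I i and ends no
  -- earlier than the k-th, contains it.
  have right : ∀ k m, k ≠ m → s i < (I (x k)).fst → s i < (I (x m)).fst →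
      (I (x k)).snd ≤ (I (x m)).snd → False := by
    intro k m hkm h1 h2 h3
    have hk := hp (x k) i (hi k).symm (hl k).symm
    have hsnd : (I i).snd < s (x k) := by
      by_contra! hc
      exact hk ⟨(hs i).1.trans (h1.le.trans (hs (x k)).1), hc⟩
    refine hp (x k) (x m) (fun e => hkm (hx e.symm)) ((hl m).trans (hl k).symm) ⟨?_, ?_⟩
    · exact (meets_iff.1 (hm m)).1.trans hsnd.le
    · exact (hs (x k)).2.trans h3
  have left : ∀ k m, k ≠ m → (I (x k)).snd < s i → (I (x m)).snd < s i →
      (I (x m)).fst ≤ (I (x k)).fst → False := by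
    intro k m hkm h1 h2 h3
    have hk := hp (x k) i (hi k).symm (hl k).symm
    have hfst : s (x k) < (I i).fst := by
      by_contra! hc
      exact hk ⟨hc, ((hs (x k)).2.trans h1.le).trans (hs i).2⟩
    refine hp (x k) (x m) (fun e => hkm (hx e.symm)) ((hl m).trans (hl k).symm) ⟨?_, ?_⟩
    · exact h3.trans (hs (x k)).1
    · exact hfst.le.trans (meets_iff.1 (hm m)).2
  have side : ∀ k, s i < (I (x k)).fst ∨ (I (x k)).snd < s i := by
    intro k
    by_contra! hc
    exact hp i (x k) (hi k) (hl k) ⟨hc.1, hc.2⟩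
  have pair : ∀ k m, k ≠ m → ¬ (s i < (I (x k)).fst ↔ s i < (I (x m)).fst) := by
    intro k m hkm h
    by_cases hk : s i < (I (x k)).fst
    · rcases le_total (I (x k)).snd (I (x m)).snd with hle | hle
      · exact right k m hkm hk (h.1 hk) hle
      · exact right m k hkm.symm (h.1 hk) hk hle
    · have h1 := (side k).resolve_left hk
      have h2 := (side m).resolve_left (mt h.2 hk)
      rcases le_total (I (x m)).fst (I (x k)).fst with hle | hle
      · exact left k m hkm h1 h2 hle
      · exact left m k hkm.symm h2 h1 hle
  -- Pigeonhole: three intervals, two sides.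
  have h01 := pair 0 1 (by decide)
  have h02 := pair 0 2 (by decide)
  have h12 := pair 1 2 (by decide)
  tauto

/-- At a common point the earlier interval occupies level 0, so the height met by the later one is
positive. This independence of level 0 saves two colours. -/
theorem IsLevel.not_meets_of_zero (hL : IsLevel I L) {i j : ℕ} (hij : j < i) (hj : L j = 0)
    (hi : L i = 0) : ¬ Meets (I j) (I i) := by
  rintro ⟨t, h1, h2⟩
  have h3 : slsHeight I L i t ≤ L i := (hL i).2 ⟨t, h2, rfl⟩
  have h4 : L j ≠ slsHeight I L i t := ne_slsHeight hij h1
  omega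

/-- Existence of a free offset. -/
theorem IsLevel.offset_nonempty (hL : IsLevel I L) (o : ℕ → ℕ) (i : ℕ) :
    (({1, 2, 3} : Set ℕ) \ {c | ∃ j < i, Meets (I j) (I i) ∧ L j = L i ∧ o j = c}).Nonempty := by
  by_contra hne
  rw [Set.not_nonempty_iff_eq_empty, Set.sdiff_eq_empty] at hne
  have h : ∀ k : Fin 3, ∃ j < i, Meets (I j) (I i) ∧ L j = L i ∧ o j = k + 1 := by
    intro k
    refine hne ?_
    fin_cases k <;> simp
  choose x h1 h2 h3 h4 using h
  refine hL.not_three (x := x) (fun k m hkm => ?_) (fun k => (h1 k).ne) h3 h2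
  have := h4 k
  rw [hkm, h4 m] at this
  exact Fin.ext (by omega)

/-- The level of the `i`-th interval. -/
noncomputable def ktLevel (I : ℕ → NonemptyInterval α) (i : ℕ) : ℕ :=
  sSup {h | ∃ t ∈ I i, h = sInf {y : ℕ | ∀ j, (_ : j < i) → t ∈ I j → ktLevel I j ≠ y}}
termination_by i

/-- The offset of the `i`-th interval, for given levels. -/
noncomputable def ktOffset (I : ℕ → NonemptyInterval α) (L : ℕ → ℕ) (i : ℕ) : ℕ :=
  sInf (({1, 2, 3} : Set ℕ) \
    {c | ∃ j, ∃ (_ : j < i), Meets (I j) (I i) ∧ L j = L i ∧ ktOffset I L j = c})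
termination_by i

theorem isLevel_ktLevel (I : ℕ → NonemptyInterval α) : IsLevel I (ktLevel I) := by
  classical
  intro i
  have hne : {h | ∃ t ∈ I i, h = slsHeight I (ktLevel I) i t}.Nonempty :=
    ⟨_, (I i).fst, ⟨le_rfl, (I i).fst_le_snd⟩, rfl⟩
  -- Boundedness makes the supremum an attained maximum; an unbounded set would have supremum 0 by
  -- convention.
  have hbdd : BddAbove {h | ∃ t ∈ I i, h = slsHeight I (ktLevel I) i t} := by
    refine ⟨i, ?_⟩
    rintro h ⟨t, -, rfl⟩
    refine (slsHeight_le_card i t).trans ((Finset.card_filter_le _ _).trans ?_)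
    simp
  have e : ktLevel I i = sSup {h | ∃ t ∈ I i, h = slsHeight I (ktLevel I) i t} := by
    rw [ktLevel]; rfl
  rw [e]
  exact ⟨Nat.sSup_mem hne hbdd, fun h hh => le_csSup hbdd hh⟩

theorem isKTSLS_ktLevel (I : ℕ → NonemptyInterval α) :
    IsKTSLS I (ktLevel I) (ktOffset I (ktLevel I)) := by
  refine ⟨isLevel_ktLevel I, fun i => ?_⟩
  have e : ktOffset I (ktLevel I) i = sInf (({1, 2, 3} : Set ℕ) \
      {c | ∃ j < i, Meets (I j) (I i) ∧ ktLevel I j = ktLevel I i ∧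
        ktOffset I (ktLevel I) j = c}) := by
    rw [ktOffset]; simp only [exists_prop]
  rw [e]
  exact ⟨Nat.sInf_mem ((isLevel_ktLevel I).offset_nonempty _ i), fun c hc => Nat.sInf_le hc⟩

namespace IsKTSLS

theorem isLevel (h : IsKTSLS I L o) : IsLevel I L := h.level

theorem ne_of_meets (h : IsKTSLS I L o) {i j : ℕ} (hij : j < i) (hm : Meets (I j) (I i)) :
    (L j, o j) ≠ (L i, o i) := by
  intro e
  rw [Prod.mk.injEq] at e
  exact (h.offset i).1.2 ⟨j, hij, hm, e.1, e.2⟩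

theorem offset_eq_one (h : IsKTSLS I L o) {i : ℕ} (hi : L i = 0) : o i = 1 := by
  have h1 : o i ≤ 1 := by
    refine (h.offset i).2 ⟨by simp, ?_⟩
    rintro ⟨j, hj, hm, hl, -⟩
    exact h.isLevel.not_meets_of_zero hj (hl.trans hi) hi hm
  have h2 := (h.offset i).1.1
  simp only [Set.mem_insert_iff, Set.mem_singleton_iff] at h2
  omega

/-- At a point t where the level is attained, at least L i earlier intervals pass through t;
together with I i they form a clique. -/
theorem level_lt_cliqueNum (h : IsKTSLS I L o) {n i : ℕ} (hi : i < n) :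
    L i < (intervalGraph I n).cliqueNum := by
  classical
  obtain ⟨⟨t, ht, e⟩, -⟩ := h.level i
  set K : Finset (Fin n) := Finset.univ.filter fun j => (j : ℕ) ≤ i ∧ t ∈ I j with hK
  have hc : (intervalGraph I n).IsClique K := by
    intro a ha b hb hab
    simp only [hK, Finset.coe_filter, Finset.mem_univ, true_and, Set.mem_ofPred_eq] at ha hb
    exact ⟨hab, t, ha.2, hb.2⟩
  refine lt_of_lt_of_le ?_ hc.card_le_cliqueNum
  rw [e, ← Nat.succ_le_iff]
  refine (Nat.succ_le_succ (slsHeight_le_card i t)).trans ?_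
  have : insert i ((Finset.range i).filter fun j => t ∈ I j) ⊆ K.map Fin.valEmbedding := by
    intro j hj
    simp only [Finset.mem_insert, Finset.mem_filter, Finset.mem_range] at hj
    simp only [Finset.mem_map, hK, Finset.mem_filter, Finset.mem_univ, true_and,
      Fin.valEmbedding_apply]
    rcases hj with rfl | hj
    · exact ⟨⟨j, hi⟩, ⟨le_rfl, ht⟩, rfl⟩
    · exact ⟨⟨j, hj.1.trans hi⟩, ⟨hj.1.le, hj.2⟩, rfl⟩
  have := Finset.card_le_card this
  rwa [Finset.card_insert_of_notMem (by simp), Finset.card_map] at this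

theorem card_colors_le (h : IsKTSLS I L o) {n : ℕ} (hn : 1 ≤ n) :
    ((Finset.range n).image fun i => (L i, o i)).card + 2 ≤
      3 * (intervalGraph I n).cliqueNum := by
  have hpos := h.level_lt_cliqueNum (i := 0) (n := n) (by omega)
  -- One colour on level 0 and three on each level from 1 to ω - 1.
  have : ((Finset.range n).image fun i => (L i, o i)) ⊆
      insert (0, 1) (Finset.Ico 1 (intervalGraph I n).cliqueNum ×ˢ ({1, 2, 3} : Finset ℕ)) := by
    intro c hc
    obtain ⟨i, hi, rfl⟩ := Finset.mem_image.1 hc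
    have h1 := h.level_lt_cliqueNum (Finset.mem_range.1 hi)
    rw [Finset.mem_insert]
    by_cases h0 : L i = 0
    · left; rw [h0, h.offset_eq_one h0]
    · right
      have h2 := (h.offset i).1.1
      simp only [Set.mem_insert_iff, Set.mem_singleton_iff] at h2
      simp only [Finset.mem_product, Finset.mem_Ico, Finset.mem_insert, Finset.mem_singleton]
      exact ⟨by omega, h2⟩
  have h2 := (Finset.card_le_card this).trans (Finset.card_insert_le _ _)
  rw [Finset.card_product, Nat.card_Ico] at h2
  simp at h2
  omega

end IsKTSLS

open Classical in
theorem card_meets_le (I : ℕ → NonemptyInterval α) {N i : ℕ} (hi : i < N) :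
    ((Finset.range N).filter fun j => Meets (I j) (I i)).card ≤ maxDeg I N + 1 := by
  have h1 := (intervalGraph I N).degree_le_maxDegree ⟨i, hi⟩
  rw [← SimpleGraph.card_neighborFinset_eq_degree] at h1
  have h2 : ((Finset.range N).filter fun j => Meets (I j) (I i)) ⊆
      insert i (((intervalGraph I N).neighborFinset ⟨i, hi⟩).map Fin.valEmbedding) := by
    intro j hj
    simp only [Finset.mem_filter, Finset.mem_range] at hj
    by_cases h : j = i
    · simp [h]
    · refine Finset.mem_insert_of_mem (Finset.mem_map.2 ⟨⟨j, hj.1⟩, ?_, rfl⟩)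
      rw [SimpleGraph.mem_neighborFinset]
      exact ⟨by simpa [Fin.ext_iff] using Ne.symm h, hj.2.symm⟩
  refine (Finset.card_le_card h2).trans ((Finset.card_insert_le _ _).trans ?_)
  rw [Finset.card_map]
  exact Nat.succ_le_succ h1

theorem IsLevel.le_maxDeg (h : IsLevel I L) {N i : ℕ} (hi : i < N) : L i ≤ maxDeg I N := by
  classical
  obtain ⟨⟨t, ht, e⟩, -⟩ := h i
  rw [← Nat.succ_le_succ_iff, e]
  refine le_trans (Nat.succ_le_succ (slsHeight_le_card i t)) (le_trans ?_ (card_meets_le I hi))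
  have : insert i ((Finset.range i).filter fun j => t ∈ I j) ⊆
      (Finset.range N).filter fun j => Meets (I j) (I i) := by
    intro j hj
    simp only [Finset.mem_insert, Finset.mem_filter, Finset.mem_range] at hj ⊢
    rcases hj with rfl | hj
    · exact ⟨hi, .refl _⟩
    · exact ⟨hj.1.trans hi, t, hj.2, ht⟩
  have := Finset.card_le_card this
  rwa [Finset.card_insert_of_notMem (by simp)] at this

end IntervalColoring

namespace IntervalColoring

/-! ### Counting visited entries in terms of the maximum degree -/

variable {α : Type} [LinearOrder α]

namespace ITree

/-- A valid tree with the given entries. -/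
structure Holds (t : ITree α) (es : List (α × α × ℕ)) : Prop where
  balanced : t.Balanced
  sorted : t.Sorted
  perm : t.entries.Perm es

theorem Holds.leaf : (leaf : ITree α).Holds [] := ⟨trivial, List.Pairwise.nil, List.Perm.nil⟩

theorem Holds.insert {t : ITree α} {es fs : List (α × α × ℕ)} (h : t.Holds es) {x y : α} {k : ℕ}
    (hfs : fs.Perm ((x, y, k) :: es)) : (ITree.insert x y k t).val.Holds fs :=
  ⟨(h.balanced.insert x y k).1, h.sorted.insert x y k,
    ((perm_entries_insert t x y k).trans (h.perm.cons _)).trans hfs.symm⟩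

theorem Holds.ht_le {t : ITree α} {es : List (α × α × ℕ)} (h : t.Holds es) {M : ℕ}
    (hM : es.length ≤ M) : t.ht ≤ 2 * Nat.log 2 (M + 1) + 1 :=
  h.balanced.ht_le (h.perm.length_eq ▸ hM)

theorem Holds.mem_intersection {t : ITree α} {es : List (α × α × ℕ)} (h : t.Holds es) {x y : α}
    {k : ℕ} : k ∈ (t.intersection x y).val ↔ ∃ a b, (a, b, k) ∈ es ∧ a ≤ y ∧ x ≤ b := by
  rw [h.balanced.val_intersection h.sorted, mem_hits]
  simp only [h.perm.mem_iff]

theorem Holds.length_intersection {t : ITree α} {es : List (α × α × ℕ)} (h : t.Holds es)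
    (x y : α) : (t.intersection x y).val.length =
      es.countP fun e => decide (e.1 ≤ y ∧ x ≤ e.2.1) := by
  rw [h.balanced.val_intersection h.sorted, length_hits, h.perm.countP_eq]

open Classical in
theorem Holds.time_intersection_le {t : ITree α} {es : List (α × α × ℕ)} (h : t.Holds es)
    (x y : α) : (t.intersection x y).time ≤
      4 + 12 * t.ht + 8 * es.countP fun e => Near x y es e := by
  have h1 := h.balanced.time_intersection_le h.sorted x y
  rw [h.perm.countP_eq] at h1
  refine h1.trans_eq ?_
  congr 3
  funext e
  exact decide_eq_decide.2 (by simp only [Near, h.perm.mem_iff])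

end ITree

theorem countP_range (p : ℕ → Prop) [DecidablePred p] (n : ℕ) :
    (List.range n).countP (fun j => decide (p j)) = ((Finset.range n).filter p).card := by
  rw [← Nat.count_eq_card_filter_range, Nat.count]

/-- The tree entry of the `i`-th interval. -/
def entry (I : ℕ → NonemptyInterval α) (i : ℕ) : α × α × ℕ := ((I i).fst, (I i).snd, i)

section Counting

variable {I : ℕ → NonemptyInterval α} {N M : ℕ}

open Classical in
/-- Every one of the first `N` intervals meets at most `M + 1` of them. -/
def DegLE (I : ℕ → NonemptyInterval α) (N M : ℕ) : Prop :=
  ∀ i < N, ((Finset.range N).filter fun j => Meets (I j) (I i)).card ≤ M + 1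

open Classical in
theorem DegLE.countP_le (hM : DegLE I N M) {n i : ℕ} (hn : n ≤ N) (hi : i < N) {J : List ℕ}
    (hJ : J.Sublist (List.range n)) {x y : α} (hx : (I i).fst ≤ x) (hy : y ≤ (I i).snd) :
    (J.map (entry I)).countP (fun e => decide (e.1 ≤ y ∧ x ≤ e.2.1)) ≤ M + 1 := by
  rw [List.countP_map]
  refine (hJ.countP_le).trans ?_
  refine le_trans (List.countP_mono_left
    (q := fun j => decide (Meets (I j) (I i))) fun j _ hj => ?_) ?_
  · replace hj := of_decide_eq_true hj
    refine decide_eq_true ?_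
    simp only [entry] at hj
    exact meets_iff.2 ⟨hj.1.trans hy, hx.trans hj.2⟩
  · rw [countP_range]
    exact (Finset.card_le_card (Finset.filter_subset_filter _
      (Finset.range_subset_range.2 hn))).trans (hM i hi)

-- Let f be the entry with the smallest left endpoint among those that meet [x, y]. A `Near` entry
-- starts between the start of f and y. If it starts before f ends, it meets f; otherwise it starts
-- inside [x, y] and meets I i. Each of the two neighbourhoods has at most M + 1 members.
open Classical in
theorem DegLE.countP_near_le (hM : DegLE I N M) {n i : ℕ} (hn : n ≤ N) (hi : i < N) {J : List ℕ}
    (hJ : J.Sublist (List.range n)) {x y : α} (hx : (I i).fst ≤ x) (hy : y ≤ (I i).snd) :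
    (J.map (entry I)).countP (fun e => ITree.Near x y (J.map (entry I)) e) ≤ 2 * (M + 1) := by
  have hlt : ∀ j ∈ J, j < n := fun j hj => List.mem_range.1 (hJ.subset hj)
  by_cases hne : ∃ f ∈ J, x ≤ (I f).snd ∧ (I f).fst ≤ y
  · obtain ⟨f, hf, hmin⟩ := Finset.exists_min_image
      (J.toFinset.filter fun f => x ≤ (I f).snd ∧ (I f).fst ≤ y) (fun f => (I f).fst)
      (by obtain ⟨f, h1, h2⟩ := hne; exact ⟨f, by simp [h1, h2]⟩)
    simp only [Finset.mem_filter, List.mem_toFinset] at hf hmin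
    rw [List.countP_map]
    refine (hJ.countP_le).trans ?_
    refine le_trans (List.countP_mono_left
      (q := fun j => decide (Meets (I j) (I f) ∨ Meets (I j) (I i))) fun j _ hj => ?_) ?_
    · simp only [Function.comp, entry, decide_eq_true_eq, ITree.Near, List.mem_map] at hj ⊢
      obtain ⟨h1, _, ⟨g, hg, rfl⟩, h2, h3⟩ := hj
      have h4 := (hmin g ⟨hg, h2, h3.trans h1⟩).trans h3
      by_cases h5 : (I j).fst ≤ (I f).snd
      · exact Or.inl (meets_iff.2 ⟨h5, h4.trans (I j).fst_le_snd⟩)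
      · exact Or.inr (meets_iff.2 ⟨h1.trans hy,
          hx.trans (hf.2.1.trans ((not_le.1 h5).le.trans (I j).fst_le_snd))⟩)
    · rw [countP_range, Finset.filter_or]
      refine (Finset.card_union_le _ _).trans ?_
      have hs : Finset.range n ⊆ Finset.range N := Finset.range_subset_range.2 hn
      have h1 := (Finset.card_le_card (Finset.filter_subset_filter _ hs)).trans
        (hM f ((hlt f hf.1).trans_le hn))
      have h2 := (Finset.card_le_card (Finset.filter_subset_filter _ hs)).trans (hM i hi)
      omega
  · rw [List.countP_eq_zero.2]
    · omega
    · intro e _ he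
      simp only [decide_eq_true_eq, ITree.Near, List.mem_map] at he
      obtain ⟨h1, _, ⟨g, hg, rfl⟩, h2, h3⟩ := he
      exact hne ⟨g, hg, h2, h3.trans h1⟩

/-- `pt 0, …, pt (m - 1)` are distinct endpoints of the first `n` intervals. -/
structure IsEndpoints (I : ℕ → NonemptyInterval α) (n m : ℕ) (pt : ℕ → α) : Prop where
  inj : ∀ a < m, ∀ b < m, pt a = pt b → a = b
  mem : ∀ k < m, ∃ i < n, pt k = (I i).fst ∨ pt k = (I i).snd

open Classical in
theorem IsEndpoints.card_le {n m : ℕ} {pt : ℕ → α} (h : IsEndpoints I n m pt) (p : α → Prop) :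
    ((Finset.range m).filter fun k => p (pt k)).card ≤
      2 * ((Finset.range n).filter fun i => p (I i).fst ∨ p (I i).snd).card := by
  have h1 : (((Finset.range m).filter fun k => p (pt k)).image pt).card =
      ((Finset.range m).filter fun k => p (pt k)).card := by
    refine Finset.card_image_of_injOn fun a ha b hb e => ?_
    simp only [Finset.coe_filter, Finset.mem_range, Set.mem_ofPred_eq] at ha hb
    exact h.inj a ha.1 b hb.1 e
  rw [← h1]
  set F := (Finset.range n).filter fun i => p (I i).fst ∨ p (I i).snd
  have h2 : ((Finset.range m).filter fun k => p (pt k)).image pt ⊆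
      F.image (fun i => (I i).fst) ∪ F.image fun i => (I i).snd := by
    intro t ht
    obtain ⟨k, hk, rfl⟩ := Finset.mem_image.1 ht
    simp only [Finset.mem_filter, Finset.mem_range] at hk
    obtain ⟨i, hi, e⟩ := h.mem k hk.1
    rw [Finset.mem_union, Finset.mem_image, Finset.mem_image]
    rcases e with e | e
    · exact Or.inl ⟨i, by simp [F, hi, ← e, hk.2], e.symm⟩
    · exact Or.inr ⟨i, by simp [F, hi, ← e, hk.2], e.symm⟩
  have h3 := Finset.card_image_le (s := F) (f := fun i => (I i).fst)
  have h4 := Finset.card_image_le (s := F) (f := fun i => (I i).snd)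
  have := (Finset.card_le_card h2).trans (Finset.card_union_le _ _)
  omega

theorem IsEndpoints.le {n m : ℕ} {pt : ℕ → α} (h : IsEndpoints I n m pt) : m ≤ 2 * n := by
  simpa using h.card_le fun _ => True

/-- The tree entry of the `k`-th endpoint. -/
def pointEntry (pt : ℕ → α) (k : ℕ) : α × α × ℕ := (pt k, pt k, k)

theorem IsEndpoints.countP_le {n m : ℕ} {pt : ℕ → α} (h : IsEndpoints I n m pt)
    (hM : DegLE I N M) {i : ℕ} (hn : n ≤ N) (hi : i < N) {x y : α} (hx : (I i).fst ≤ x)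
    (hy : y ≤ (I i).snd) :
    ((List.range m).map (pointEntry pt)).countP (fun e => decide (e.1 ≤ y ∧ x ≤ e.2.1)) ≤
      2 * (M + 1) := by
  classical
  rw [List.countP_map]
  refine le_trans (le_of_eq (countP_range (fun k => pt k ≤ y ∧ x ≤ pt k) m)) ?_
  -- The two filters differ only in their decidability instances.
  refine le_trans (le_of_eq (by congr)) ((h.card_le fun t => t ≤ y ∧ x ≤ t).trans ?_)
  refine Nat.mul_le_mul_left 2 (le_trans (Finset.card_le_card fun j hj => ?_) (hM i hi))
  simp only [Finset.mem_filter, Finset.mem_range] at hj ⊢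
  refine ⟨hj.1.trans_le hn, meets_iff.2 ?_⟩
  have := (I j).fst_le_snd
  rcases hj.2 with ⟨h1, h2⟩ | ⟨h1, h2⟩
  · exact ⟨h1.trans hy, hx.trans (h2.trans this)⟩
  · exact ⟨this.trans (h1.trans hy), hx.trans h2⟩

-- For one-point entries `Near` is the same as being hit: a point not before a point that reaches x
-- reaches x itself.
open Classical in
theorem IsEndpoints.countP_near_le {n m : ℕ} {pt : ℕ → α} (h : IsEndpoints I n m pt)
    (hM : DegLE I N M) {i : ℕ} (hn : n ≤ N) (hi : i < N) {x y : α} (hx : (I i).fst ≤ x)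
    (hy : y ≤ (I i).snd) :
    ((List.range m).map (pointEntry pt)).countP
      (fun e => ITree.Near x y ((List.range m).map (pointEntry pt)) e) ≤ 2 * (M + 1) := by
  refine le_trans (List.countP_mono_left fun e he h => ?_) (h.countP_le hM hn hi hx hy)
  simp only [ITree.Near, List.mem_map, decide_eq_true_eq] at he h ⊢
  obtain ⟨k, -, rfl⟩ := he
  obtain ⟨h1, _, ⟨g, -, rfl⟩, h2, h3⟩ := h
  exact ⟨h1, h2.trans h3⟩

end Counting

/-! ### Loops of the algorithm: results and costs -/

namespace State

/-- The level stored for interval `j`. -/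
def levelAt (colors : DynArray ColorRec) (j : ℕ) : Option ℕ := colors.elems[j]?.bind (·.level)

/-- The offset stored for interval `j`. -/
def offsetAt (colors : DynArray ColorRec) (j : ℕ) : Option ℕ := colors.elems[j]?.bind (·.offset)

theorem collectLevels_spec (colors : DynArray ColorRec) (is : List ℕ) (h : ℕ) (U : List ℕ)
    (hU : ∀ l ∈ U, l ≤ h) :
    (∀ l, l ∈ (collectLevels colors is h U).val.2 ↔ l ∈ U ∨ ∃ j ∈ is, levelAt colors j = some l) ∧
    (collectLevels colors is h U).val.2.length ≤ U.length + is.length ∧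
    (∀ l ∈ (collectLevels colors is h U).val.2, l ≤ (collectLevels colors is h U).val.1) ∧
    (∀ M, h ≤ M → (∀ j ∈ is, ∀ l, levelAt colors j = some l → l ≤ M) →
      (collectLevels colors is h U).val.1 ≤ M) ∧
    (collectLevels colors is h U).time ≤ 3 * is.length + 1 := by
  induction is generalizing h U with
  | nil => simpa [collectLevels] using hU
  | cons i is ih =>
    simp only [collectLevels, Timed.val_bind, DynArray.val_get, Timed.time_bind, DynArray.time_get]
    split
    · rename_i l o hl
      have hlev : levelAt colors i = some l := by simp [levelAt, hl]
      obtain ⟨a1, a2, a3, a4, a5⟩ := ih (max h l) (l :: U) (by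
        simp only [List.mem_cons, forall_eq_or_imp, le_max_right, true_and]
        exact fun u hu => (hU u hu).trans (le_max_left _ _))
      simp only [Timed.val_bind, Timed.val_op, Timed.time_bind, Timed.time_op, List.length_cons]
      simp only [List.length_cons] at a2
      refine ⟨fun m => ?_, by omega, a3, fun M hM hm => ?_, by omega⟩
      · rw [a1]
        simp only [List.mem_cons, exists_eq_or_imp, hlev, Option.some.injEq]
        tauto
      · simp only [List.mem_cons, forall_eq_or_imp] at hm
        exact a4 M (max_le hM (hm.1 l hlev)) hm.2
    · rename_i hl
      have hlev : levelAt colors i = none := by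
        rcases hi : colors.elems[i]? with _ | ⟨_ | l, o⟩
        · simp [levelAt, hi]
        · simp [levelAt, hi]
        · exact absurd hi (hl l o)
      obtain ⟨a1, a2, a3, a4, a5⟩ := ih h U hU
      simp only [List.length_cons]
      refine ⟨fun m => ?_, by omega, a3, fun M hM hm => ?_, by omega⟩
      · rw [a1]
        simp [hlev]
      · simp only [List.mem_cons, forall_eq_or_imp] at hm
        exact a4 M hM hm.2

theorem usedOffsets_spec (colors : DynArray ColorRec) (is : List ℕ) (u1 u2 : Bool) :
    ((usedOffsets colors is u1 u2).val.1 = true ↔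
      u1 = true ∨ ∃ j ∈ is, offsetAt colors j = some 1) ∧
    ((usedOffsets colors is u1 u2).val.2 = true ↔
      u2 = true ∨ ∃ j ∈ is, offsetAt colors j = some 2) ∧
    (usedOffsets colors is u1 u2).time ≤ 3 * is.length + 1 := by
  induction is generalizing u1 u2 with
  | nil => simp [usedOffsets]
  | cons i is ih =>
    simp only [usedOffsets, Timed.val_bind, DynArray.val_get, Timed.time_bind, DynArray.time_get]
    split
    · rename_i l o hl
      have hoff : offsetAt colors i = some o := by simp [offsetAt, hl]
      simp only [Timed.val_bind, Timed.val_op, Timed.time_bind, Timed.time_op, List.length_cons]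
      obtain ⟨a1, a2, a3⟩ := ih (u1 || o == 1) (u2 || o == 2)
      refine ⟨?_, ?_, by omega⟩
      · rw [a1]; simp [hoff, or_assoc]
      · rw [a2]; simp [hoff, or_assoc]
    · rename_i hl
      have hoff : offsetAt colors i = none := by
        rcases hi : colors.elems[i]? with _ | ⟨l, _ | o⟩
        · simp [offsetAt, hi]
        · simp [offsetAt, hi]
        · exact absurd hi (hl l o)
      obtain ⟨a1, a2, a3⟩ := ih u1 u2
      simp only [List.length_cons]
      refine ⟨?_, ?_, by omega⟩
      · rw [a1]; simp [hoff]
      · rw [a2]; simp [hoff]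

theorem maxHeight_spec (sls : DynArray SLS) (ks : List ℕ) (h : ℕ) :
    h ≤ (maxHeight sls ks h).val ∧
    (∀ k ∈ ks, ∀ e, sls.elems[k]? = some e → e.height.val ≤ (maxHeight sls ks h).val) ∧
    ((maxHeight sls ks h).val = h ∨
      ∃ k ∈ ks, ∃ e, sls.elems[k]? = some e ∧ e.height.val = (maxHeight sls ks h).val) ∧
    (maxHeight sls ks h).time ≤ 4 * ks.length + 1 := by
  induction ks generalizing h with
  | nil => simp [maxHeight]
  | cons k ks ih =>
    simp only [maxHeight, Timed.val_bind, DynArray.val_get, Timed.time_bind, DynArray.time_get]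
    split
    · rename_i e he
      obtain ⟨a1, a2, a3, a4⟩ := ih (max h e.height.val)
      have := e.time_height_le
      simp only [Timed.val_bind, Timed.val_op, Timed.time_bind, Timed.time_op, List.length_cons]
      refine ⟨(le_max_left _ _).trans a1, ?_, ?_, by omega⟩
      · simp only [List.mem_cons, forall_eq_or_imp]
        refine ⟨fun e' he' => ?_, a2⟩
        rw [he] at he'
        cases he'
        exact (le_max_right _ _).trans a1
      · rcases a3 with a3 | ⟨k', hk', r⟩
        · rcases le_total h e.height.val with hle | hle
          · exact Or.inr ⟨k, by simp, e, he, by rw [a3, max_eq_right hle]⟩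
          · left; rw [a3, max_eq_left hle]
        · exact Or.inr ⟨k', by simp [hk'], r⟩
    · rename_i he
      obtain ⟨a1, a2, a3, a4⟩ := ih h
      simp only [List.length_cons]
      refine ⟨a1, ?_, ?_, by omega⟩
      · simp only [List.mem_cons, forall_eq_or_imp]
        exact ⟨fun e' he' => by simp [he] at he', a2⟩
      · rcases a3 with a3 | ⟨k', hk', r⟩
        · exact Or.inl a3
        · exact Or.inr ⟨k', by simp [hk'], r⟩

theorem growTable_spec {β : Type} (k : ℕ) {T : DynArray (ITree β)} (hT : T.WF) :
    (growTable k T).val.WF ∧ (growTable k T).val.elems.size = T.elems.size + k ∧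
    (∀ l tr, (growTable k T).val.elems[l]? = some tr →
      T.elems[l]? = some tr ∨ (T.elems.size ≤ l ∧ tr = .leaf)) ∧
    (growTable k T).time + 3 * T.cap ≤ 3 * (growTable k T).val.cap + 3 * k + 1 := by
  induction k generalizing T with
  | zero => exact ⟨hT, rfl, fun l tr h => Or.inl h, by simp [growTable]; omega⟩
  | succ k ih =>
    obtain ⟨a1, a2, a3, a4⟩ := ih (hT.push .leaf)
    have := hT.time_push_le .leaf
    simp only [growTable, Timed.val_bind, Timed.time_bind]
    refine ⟨a1, by rw [a2]; simp; omega, fun l tr h => ?_, by omega⟩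
    rcases a3 l tr h with h | ⟨h1, h2⟩
    · rw [DynArray.elems_push, Array.getElem?_push] at h
      split at h
      · rename_i e
        exact Or.inr ⟨e.ge, by simpa using h.symm⟩
      · exact Or.inl h
    · rw [DynArray.elems_push, Array.size_push] at h1
      exact Or.inr ⟨by omega, h2⟩

/-- The total potential of the supporting line segments. -/
def slsPot (sls : DynArray SLS) : ℕ := (sls.elems.toList.map SLS.pot).sum

theorem slsPot_set (sls : DynArray SLS) {k : ℕ} {e : SLS} (he : sls.elems[k]? = some e) (e' : SLS) :
    slsPot (sls.set k e').val + e.pot = slsPot sls + e'.pot := by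
  have key : ∀ (l : List SLS) (k : ℕ), l[k]? = some e →
      ((l.set k e').map SLS.pot).sum + e.pot = (l.map SLS.pot).sum + e'.pot := by
    intro l
    induction l with
    | nil => simp
    | cons a l ih =>
      intro k hk
      rcases k with _ | k
      · simp at hk
        subst hk
        simp
        omega
      · simp at hk
        have := ih k hk
        simp only [List.set_cons_succ, List.map_cons, List.sum_cons]
        omega
  simp only [slsPot, DynArray.elems_set, Array.toList_setIfInBounds]
  exact key _ k (by simpa using he)

/-- Extending the arrays is paid for by the increase of the potential; what remains is a constant
per listed endpoint, 11 of the 16 for `mark`. -/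
theorem updateEndpoints_spec (l : ℕ) (ks : List ℕ) (sls : DynArray SLS)
    (hv : ∀ (k : ℕ) (e : SLS), sls.elems[k]? = some e → e.Valid) :
    (updateEndpoints l ks sls).val.elems.size = sls.elems.size ∧
    (updateEndpoints l ks sls).val.cap = sls.cap ∧
    (∀ (k : ℕ) (e : SLS), sls.elems[k]? = some e → ∃ e',
      (updateEndpoints l ks sls).val.elems[k]? = some e' ∧
      e'.Valid ∧ (∀ j, e'.Marked j ↔ e.Marked j ∨ (k ∈ ks ∧ j = l)) ∧
      e'.A.elems.size ≤ max e.A.elems.size (l + 1)) ∧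
    (updateEndpoints l ks sls).time + slsPot sls ≤
      slsPot (updateEndpoints l ks sls).val + 16 * ks.length + 1 := by
  induction ks generalizing sls with
  | nil =>
    refine ⟨rfl, rfl, fun k e he => ⟨e, he, hv k e he, by simp, by simp⟩, ?_⟩
    simp [updateEndpoints]
    omega
  | cons k ks ih =>
    simp only [updateEndpoints, Timed.val_bind, DynArray.val_get, Timed.time_bind,
      DynArray.time_get]
    split
    · rename_i e he
      obtain ⟨g1, g2, g3, g4⟩ := (hv k e he).growBy (l + 1 - e.A.elems.size)
      obtain ⟨m1, m2, m3, m4, m5⟩ := g1.mark (l := l) (by omega)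
      simp only [Timed.val_bind, Timed.val_op, Timed.time_bind, Timed.time_op, List.length_cons,
        DynArray.val_size, DynArray.time_size, DynArray.time_set]
      set e1 := SLS.growBy (l + 1 - e.A.elems.size) e
      set e2 := e1.val.mark l
      have hget : ∀ k', (sls.set k e2.val).val.elems[k']? =
          if k = k' then some e2.val else sls.elems[k']? := by
        intro k'
        rw [DynArray.elems_set, Array.getElem?_setIfInBounds]
        split
        · subst k'
          simp [(Array.getElem?_eq_some_iff.1 he).1]
        · rfl
      obtain ⟨a1, a2, a3, a4⟩ := ih (sls.set k e2.val).val (by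
        intro k' e' he'
        rw [hget] at he'
        split at he'
        · cases he'; exact m1
        · exact hv k' e' he')
      have hp := slsPot_set sls he e2.val
      refine ⟨by simpa using a1, a2, fun k' e' he' => ?_, by omega⟩
      by_cases hk : k = k'
      · subst hk
        rw [he] at he'
        cases he'
        obtain ⟨e'', b1, b2, b3, b4⟩ := a3 k e2.val (by rw [hget, if_pos rfl])
        refine ⟨e'', b1, b2, fun j => ?_, by omega⟩
        rw [b3, m3, g3]
        simp
        tauto
      · obtain ⟨e'', b1, b2, b3, b4⟩ := a3 k' e' (by rw [hget, if_neg hk, he'])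
        refine ⟨e'', b1, b2, fun j => ?_, b4⟩
        rw [b3]
        simp [Ne.symm hk]
    · rename_i he
      obtain ⟨a1, a2, a3, a4⟩ := ih sls hv
      simp only [List.length_cons]
      refine ⟨a1, a2, fun k' e' he' => ?_, by omega⟩
      obtain ⟨e'', b1, b2, b3, b4⟩ := a3 k' e' he'
      have : k' ≠ k := by rintro rfl; simp [he] at he'
      exact ⟨e'', b1, b2, fun j => by rw [b3]; simp [this], b4⟩

end State

end IntervalColoring

namespace IntervalColoring

/-! ### Invariants of the data structure, queries and new endpoints -/

variable {α : Type} [LinearOrder α]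

theorem ITree.Holds.mem_intersection_entry {t : ITree α} {I : ℕ → NonemptyInterval α} {J : List ℕ}
    (h : t.Holds (J.map (entry I))) {x y : α} {j : ℕ} :
    j ∈ (t.intersection x y).val ↔ j ∈ J ∧ (I j).fst ≤ y ∧ x ≤ (I j).snd := by
  rw [h.mem_intersection]
  simp only [List.mem_map, entry, Prod.mk.injEq]
  constructor
  · rintro ⟨a, b, ⟨i, hi, rfl, rfl, rfl⟩, h1, h2⟩
    exact ⟨hi, h1, h2⟩
  · rintro ⟨hj, h1, h2⟩
    exact ⟨_, _, ⟨j, hj, rfl, rfl, rfl⟩, h1, h2⟩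

theorem ITree.Holds.mem_intersection_pointEntry {t : ITree α} {pt : ℕ → α} {m : ℕ}
    (h : t.Holds ((List.range m).map (pointEntry pt))) {x y : α} {k : ℕ} :
    k ∈ (t.intersection x y).val ↔ k < m ∧ x ≤ pt k ∧ pt k ≤ y := by
  rw [h.mem_intersection]
  simp only [List.mem_map, pointEntry, Prod.mk.injEq, List.mem_range]
  constructor
  · rintro ⟨a, b, ⟨i, hi, rfl, rfl, rfl⟩, h1, h2⟩
    exact ⟨hi, h2, h1⟩
  · rintro ⟨hj, h1, h2⟩
    exact ⟨_, _, ⟨k, hj, rfl, rfl, rfl⟩, h2, h1⟩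

/-- The parameters of an analysis of the first `N` insertions: `M` bounds the degrees and the
levels, `H` the heights of the trees. -/
structure Params (I : ℕ → NonemptyInterval α) (L o : ℕ → ℕ) (N M H : ℕ) : Prop where
  kt : IsKTSLS I L o
  deg : DegLE I N M
  level_le : ∀ i < N, L i ≤ M
  height : H = 2 * Nat.log 2 (2 * N + 1) + 1

/-- Some interval of level `l` among the first `n` contains `t`. -/
def Covered (I : ℕ → NonemptyInterval α) (L : ℕ → ℕ) (n : ℕ) (t : α) (l : ℕ) : Prop :=
  ∃ j < n, t ∈ I j ∧ L j = l

/-- The endpoints `pt k` are stored together with correct supporting line segments. -/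
structure EndsInv (I : ℕ → NonemptyInterval α) (P : α → ℕ → Prop) (M n : ℕ) (ends : ITree α)
    (sls : DynArray SLS) (pt : ℕ → α) : Prop where
  wf : sls.WF
  isEndpoints : IsEndpoints I n sls.elems.size pt
  holds : ends.Holds ((List.range sls.elems.size).map (pointEntry pt))
  valid : ∀ (k : ℕ) (e : SLS), sls.elems[k]? = some e →
    e.Valid ∧ (∀ l, e.Marked l ↔ P (pt k) l) ∧ e.A.elems.size ≤ M + 1

/-- Entry `l` of the table holds the intervals of level `l` among the first `n`. -/
structure TableInv (I : ℕ → NonemptyInterval α) (L : ℕ → ℕ) (M n : ℕ)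
    (T : DynArray (ITree α)) : Prop where
  wf : T.WF
  holds : ∀ (l : ℕ) (tr : ITree α), T.elems[l]? = some tr →
    tr.Holds (((List.range n).filter fun i => decide (L i = l)).map (entry I))
  lt_size : ∀ i < n, L i < T.elems.size
  size_le : T.elems.size ≤ M + 1

/-- The state after `n` insertions. -/
structure StateInv (I : ℕ → NonemptyInterval α) (L o : ℕ → ℕ) (M n : ℕ) (s : State α) : Prop where
  ivals : s.ivals.Holds ((List.range n).map (entry I))
  colors_wf : s.colors.WF
  colors_size : s.colors.elems.size = n
  colors : ∀ i < n, s.colors.elems[i]? = some ⟨some (L i), some (o i)⟩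
  table : TableInv I L M n s.table
  ends : ∃ pt, EndsInv I (Covered I L n) M n s.ends s.sls pt ∧
    ∀ i < n, ∃ k < s.sls.elems.size, pt k = (I i).fst

/-- The potential of a state, which pays for reallocations and for growing line segments. -/
def State.pot (s : State α) : ℕ :=
  3 * s.colors.cap + 3 * s.sls.cap + State.slsPot s.sls + 3 * s.table.cap

variable {I : ℕ → NonemptyInterval α} {L o : ℕ → ℕ} {N M H n : ℕ}

namespace Params

theorem ht_le (hP : Params I L o N M H) {t : ITree α} {es : List (α × α × ℕ)} (h : t.Holds es)
    (hes : es.length ≤ 2 * N) : t.ht ≤ H := hP.height ▸ h.ht_le hes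

theorem time_insert_le (hP : Params I L o N M H) {t : ITree α} {es : List (α × α × ℕ)}
    (h : t.Holds es) (hes : es.length ≤ 2 * N) (x y : α) (k : ℕ) :
    (ITree.insert x y k t).time ≤ 29 * H + 7 := by
  have h1 := h.balanced.time_insert_le x y k
  have h2 := hP.ht_le h hes
  omega

/-- Queries to a tree that holds some of the first `N` intervals. -/
theorem intersection_entry (hP : Params I L o N M H) {t : ITree α} {m i : ℕ} (hm : m ≤ N)
    (hi : i < N) {J : List ℕ} (hJ : J.Sublist (List.range m)) (h : t.Holds (J.map (entry I)))
    {x y : α} (hx : (I i).fst ≤ x) (hy : y ≤ (I i).snd) :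
    (t.intersection x y).val.length ≤ M + 1 ∧
      (t.intersection x y).time ≤ 4 + 12 * H + 16 * (M + 1) := by
  constructor
  · rw [h.length_intersection]
    exact hP.deg.countP_le hm hi hJ hx hy
  · have h1 := h.time_intersection_le x y
    have h2 := hP.deg.countP_near_le hm hi hJ hx hy
    have h3 := hP.ht_le h (by
      have := hJ.length_le
      rw [List.length_map]
      rw [List.length_range] at this
      omega)
    omega

/-- Queries to the tree of endpoints. -/
theorem intersection_pointEntry (hP : Params I L o N M H) {t : ITree α} {m k i : ℕ} (hm : m ≤ N)
    (hi : i < N) {pt : ℕ → α} (hpt : IsEndpoints I m k pt)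
    (h : t.Holds ((List.range k).map (pointEntry pt)))
    {x y : α} (hx : (I i).fst ≤ x) (hy : y ≤ (I i).snd) :
    (t.intersection x y).val.length ≤ 2 * (M + 1) ∧
      (t.intersection x y).time ≤ 4 + 12 * H + 16 * (M + 1) := by
  constructor
  · rw [h.length_intersection]
    exact hpt.countP_le hP.deg hm hi hx hy
  · have h1 := h.time_intersection_le x y
    have h2 := hpt.countP_near_le hP.deg hm hi hx hy
    have h3 := hP.ht_le h (by
      have := hpt.le
      rw [List.length_map, List.length_range]
      omega)
    omega

/-- The tree already contains I n, whose level is unknown at this moment; by `hlev` it is skipped,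
so the flags describe the first n intervals. New cells are charged to the potential of the new
segment, and at most M + 1 levels have to be marked. -/
theorem computeSLS_spec (hP : Params I L o N M H) (hn : n < N) {s : State α}
    (hiv : s.ivals.Holds ((List.range (n + 1)).map (entry I)))
    (hlev : ∀ j l, State.levelAt s.colors j = some l ↔ j < n ∧ L j = l) {t : α} (ht : t ∈ I n) :
    (s.computeSLS t).val.Valid ∧ (∀ l, (s.computeSLS t).val.Marked l ↔ Covered I L n t l) ∧
      (s.computeSLS t).val.A.elems.size ≤ M + 1 ∧
      (s.computeSLS t).time ≤ 12 * H + 30 * (M + 1) + 9 + (s.computeSLS t).val.pot := by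
  obtain ⟨q1, q2⟩ := hP.intersection_entry (Nat.succ_le_of_lt hn) hn (List.Sublist.refl _) hiv
    ht.1 ht.2
  simp only [State.computeSLS, Timed.val_bind, Timed.time_bind, Timed.val_op, Timed.time_op]
  set It := s.ivals.intersection t t
  have hIt : ∀ j, j ∈ It.val ↔ j < n + 1 ∧ t ∈ I j := fun j => by
    rw [hiv.mem_intersection_entry, List.mem_range]; rfl
  obtain ⟨c1, c2, c3, c4, c5⟩ := State.collectLevels_spec s.colors It.val 0 [] (by simp)
  set hU := State.collectLevels s.colors It.val 0 []
  obtain ⟨g1, g2, g3, g4⟩ := SLS.Valid.empty.growBy (hU.val.1 + 1)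
  have hz : SLS.empty.A.elems.size = 0 := rfl
  have hc : SLS.empty.pot = 0 := rfl
  obtain ⟨m1, m2, m3, m4, m5⟩ := g1.markAll hU.val.2 (fun l hl => by have := c3 l hl; omega)
  refine ⟨m1, fun l => ?_, ?_, ?_⟩
  · rw [m3, g3, c1]
    have : ¬ SLS.empty.Marked l := by simp [SLS.Marked, SLS.empty, DynArray.empty]
    simp only [this, false_or, List.not_mem_nil, hlev, hIt, Covered]
    constructor
    · rintro ⟨j, ⟨h1, h2⟩, h3, h4⟩
      exact ⟨j, h3, h2, h4⟩
    · rintro ⟨j, h3, h2, h4⟩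
      exact ⟨j, ⟨by omega, h2⟩, h3, h4⟩
  · have := c4 M (Nat.zero_le _) (fun j _ l hl => by
      obtain ⟨h1, rfl⟩ := (hlev j l).1 hl
      exact hP.level_le j (by omega))
    omega
  · simp only [List.length_nil] at c2
    omega

/-- The enumeration of endpoints may be extended, so it is also recorded that old points persist.
The coefficient 53 is 12 + 12 + 29: two queries and one insertion into a tree. -/
theorem addEndpoint_spec (hP : Params I L o N M H) (hn : n < N) {s : State α}
    (hiv : s.ivals.Holds ((List.range (n + 1)).map (entry I)))
    (hlev : ∀ j l, State.levelAt s.colors j = some l ↔ j < n ∧ L j = l) {pt : ℕ → α}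
    (hE : EndsInv I (Covered I L n) M (n + 1) s.ends s.sls pt) {t : α}
    (ht : t = (I n).fst ∨ t = (I n).snd) :
    (s.addEndpoint t).val.ivals = s.ivals ∧ (s.addEndpoint t).val.colors = s.colors ∧
    (s.addEndpoint t).val.table = s.table ∧
    (∃ pt', EndsInv I (Covered I L n) M (n + 1) (s.addEndpoint t).val.ends
        (s.addEndpoint t).val.sls pt' ∧
      (∃ k < (s.addEndpoint t).val.sls.elems.size, pt' k = t) ∧
      ∀ k < s.sls.elems.size, ∃ k' < (s.addEndpoint t).val.sls.elems.size, pt' k' = pt k) ∧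
    (s.addEndpoint t).time + 3 * s.sls.cap + State.slsPot s.sls ≤
      3 * (s.addEndpoint t).val.sls.cap + State.slsPot (s.addEndpoint t).val.sls +
        53 * H + 72 * (M + 1) := by
  have hmem : t ∈ I n := by
    have := (I n).fst_le_snd
    rcases ht with rfl | rfl
    exacts [⟨le_rfl, this⟩, ⟨this, le_rfl⟩]
  obtain ⟨q1, q2⟩ := hP.intersection_pointEntry (Nat.succ_le_of_lt hn) hn hE.isEndpoints hE.holds
    hmem.1 hmem.2
  simp only [State.addEndpoint, Timed.val_bind, Timed.time_bind, Timed.val_op, Timed.time_op,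
    List.isEmpty_iff]
  have hf : ∀ k, k ∈ (s.ends.intersection t t).val ↔ k < s.sls.elems.size ∧ pt k = t := fun k => by
    rw [hE.holds.mem_intersection_pointEntry, le_antisymm_iff, and_comm (a := t ≤ pt k)]
  set f := s.ends.intersection t t
  split
  · rename_i hnil
    have hnew : ∀ k < s.sls.elems.size, pt k ≠ t := fun k hk e => by
      have := (hf k).2 ⟨hk, e⟩
      simp [hnil] at this
    obtain ⟨e1, e2, e3, e4⟩ := hP.computeSLS_spec hn hiv hlev hmem
    set e := s.computeSLS t
    simp only [Timed.val_bind, Timed.time_bind, Timed.val_op, Timed.time_op, DynArray.val_size,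
      DynArray.time_size]
    have hsz : (s.sls.push e.val).val.elems.size = s.sls.elems.size + 1 := by simp
    set m := s.sls.elems.size with hm
    set pt' := Function.update pt m t with hpt'
    have hold : ∀ k < m, pt' k = pt k := fun k hk => Function.update_of_ne (by omega) _ _
    have hnw : pt' m = t := Function.update_self _ _ _
    refine ⟨trivial, trivial, trivial, ⟨pt', ⟨hE.wf.push _, ⟨?_, ?_⟩, ?_, ?_⟩, ⟨m, by omega, hnw⟩,
      fun k hk => ⟨k, by omega, hold k hk⟩⟩, ?_⟩
    · rw [hsz]
      intro a ha b hb hab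
      rcases Nat.lt_succ_iff_lt_or_eq.1 ha with ha | rfl <;>
        rcases Nat.lt_succ_iff_lt_or_eq.1 hb with hb | rfl
      · rw [hold a ha, hold b hb] at hab
        exact hE.isEndpoints.inj a ha b hb hab
      · rw [hold a ha, hnw] at hab
        exact absurd hab (hnew a ha)
      · rw [hold b hb, hnw] at hab
        exact absurd hab.symm (hnew b hb)
      · rfl
    · rw [hsz]
      intro k hk
      rcases Nat.lt_succ_iff_lt_or_eq.1 hk with hk | rfl
      · rw [hold k hk]
        exact hE.isEndpoints.mem k hk
      · rw [hnw]
        exact ⟨n, by omega, ht⟩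
    · rw [hsz, List.range_succ, List.map_append]
      have : (List.range m).map (pointEntry pt') = (List.range m).map (pointEntry pt) :=
        List.map_congr_left fun k hk => by simp [pointEntry, hold k (List.mem_range.1 hk)]
      rw [this]
      refine hE.holds.insert ?_
      simp only [List.map_cons, List.map_nil, pointEntry, hnw]
      exact List.perm_append_comm
    · intro k e' he'
      rw [DynArray.elems_push, Array.getElem?_push] at he'
      split at he'
      · rename_i hk
        cases he'
        rw [hk, ← hm, hnw]
        exact ⟨e1, e2, e3⟩
      · have hk := (Array.getElem?_eq_some_iff.1 he').1
        rw [hold k hk]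
        exact hE.valid k e' he'
    · have h1 := hE.wf.time_push_le e.val
      have h2 := hP.time_insert_le hE.holds (by
        have := hE.isEndpoints.le
        rw [List.length_map, List.length_range]
        omega) t t m
      have h3 : State.slsPot (s.sls.push e.val).val = State.slsPot s.sls + e.val.pot := by
        simp [State.slsPot]
      omega
  · rename_i hnil
    simp only [Timed.val_pure, Timed.time_pure]
    refine ⟨trivial, trivial, trivial, ⟨pt, hE, ?_, fun k hk => ⟨k, hk, rfl⟩⟩, by omega⟩
    obtain ⟨k, hk⟩ := List.exists_mem_of_ne_nil _ hnil
    exact ⟨k, (hf k).1 hk⟩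

end Params

end IntervalColoring

namespace IntervalColoring

/-! ### One insertion: offset, level, preservation of the invariants -/

variable {α : Type} [LinearOrder α]

variable {I : ℕ → NonemptyInterval α} {L o : ℕ → ℕ} {N M H n : ℕ}

namespace Params

theorem computeOffset_spec (hP : Params I L o N M H) (hn : n < N) {s : State α}
    (hoff : ∀ j < n, State.offsetAt s.colors j = some (o j)) (hT : TableInv I L M n s.table) :
    ∃ T, (s.computeOffset (I n).fst (I n).snd n (L n)).val =
        { s with table := T, colors := (s.colors.set n ⟨some (L n), some (o n)⟩).val } ∧
      TableInv I L M (n + 1) T ∧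
      (s.computeOffset (I n).fst (I n).snd n (L n)).time + 3 * s.table.cap ≤
        3 * T.cap + 41 * H + 42 * (M + 1) := by
  have hLn := hP.level_le n hn
  obtain ⟨g1, g2, g3, g4⟩ := State.growTable_spec (L n + 1 - s.table.elems.size) hT.wf
  simp only [State.computeOffset, Timed.val_bind, Timed.time_bind, Timed.val_op, Timed.time_op,
    DynArray.val_size, DynArray.time_size, DynArray.val_get, DynArray.time_get]
  have hts := hT.size_le
  set T := State.growTable (L n + 1 - s.table.elems.size) s.table
  have hholds : ∀ (l : ℕ) (tr : ITree α), T.val.elems[l]? = some tr →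
      tr.Holds (((List.range n).filter fun i => decide (L i = l)).map (entry I)) := by
    intro l tr h
    rcases g3 l tr h with h | ⟨h, rfl⟩
    · exact hT.holds l tr h
    · have : ((List.range n).filter fun i => decide (L i = l)) = [] := by
        rw [List.filter_eq_nil_iff]
        intro i hi
        have := hT.lt_size i (List.mem_range.1 hi)
        simp only [decide_eq_true_eq]
        omega
      rw [this]
      exact .leaf
  split
  · rename_i tr htr
    have htrh := hholds _ _ htr
    obtain ⟨q1, q2⟩ := hP.intersection_entry hn.le hn List.filter_sublist htrh
      le_rfl le_rfl
    have hS : ∀ j, j ∈ (tr.intersection (I n).fst (I n).snd).val ↔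
        j < n ∧ L j = L n ∧ Meets (I j) (I n) := fun j => by
      rw [htrh.mem_intersection_entry, List.mem_filter, List.mem_range, decide_eq_true_eq,
        meets_iff, and_assoc]
    simp only [Timed.val_bind, Timed.time_bind, Timed.val_op, Timed.time_op, DynArray.time_set]
    set S := tr.intersection (I n).fst (I n).snd
    obtain ⟨u1, u2, u3⟩ := State.usedOffsets_spec s.colors S.val false false
    set u := State.usedOffsets s.colors S.val false false
    have hused : ∀ c, (∃ j ∈ S.val, State.offsetAt s.colors j = some c) ↔
        ∃ j < n, Meets (I j) (I n) ∧ L j = L n ∧ o j = c := by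
      intro c
      constructor
      · rintro ⟨j, hj, hc⟩
        obtain ⟨h1, h2, h3⟩ := (hS j).1 hj
        rw [hoff j h1, Option.some.injEq] at hc
        exact ⟨j, h1, h3, h2, hc⟩
      · rintro ⟨j, h1, h3, h2, hc⟩
        exact ⟨j, (hS j).2 ⟨h1, h2, h3⟩, by rw [hoff j h1, hc]⟩
    -- Offset 3 need not be tested: `IsKTSLS` guarantees that some element of {1, 2, 3} is free.
    have ho : (if u.val.1 = true then (if u.val.2 = true then 3 else 2) else 1) = o n := by
      obtain ⟨⟨h1, h2⟩, h3⟩ := hP.kt.offset n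
      simp only [Bool.false_eq_true, false_or, hused] at u1 u2
      simp only [Set.mem_insert_iff, Set.mem_singleton_iff] at h1
      have h4 : ¬ u.val.1 = true → o n ≤ 1 := fun h => h3 ⟨by simp, fun hc => h (u1.2 hc)⟩
      have h5 : ¬ u.val.2 = true → o n ≤ 2 := fun h => h3 ⟨by simp, fun hc => h (u2.2 hc)⟩
      have h6 : u.val.1 = true → o n ≠ 1 := fun h e => h2 (e ▸ u1.1 h)
      have h7 : u.val.2 = true → o n ≠ 2 := fun h e => h2 (e ▸ u2.1 h)
      split
      · have := h6 ‹_›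
        split
        · have := h7 ‹_›
          omega
        · have := h5 ‹_›
          omega
      · have := h4 ‹_›
        omega
    rw [ho]
    refine ⟨_, rfl, ⟨g1.set _ _, ?_, ?_, ?_⟩, ?_⟩
    · intro l tr' h
      rw [List.range_succ, List.filter_append]
      rw [DynArray.elems_set, Array.getElem?_setIfInBounds] at h
      split at h
      · rename_i hl
        subst hl
        split at h
        · cases h
          refine htrh.insert ?_
          simp only [List.filter_cons, decide_true, if_true, List.filter_nil, List.map_append,
            List.map_cons, List.map_nil]
          exact List.perm_append_comm
        · cases h
      · rename_i hl
        simp only [List.filter_cons, hl, decide_false, Bool.false_eq_true, if_false,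
          List.filter_nil, List.append_nil]
        exact hholds l tr' h
    · intro i hi
      simp only [DynArray.elems_set, Array.size_setIfInBounds, g2]
      rcases Nat.lt_succ_iff_lt_or_eq.1 hi with hi | rfl
      · have := hT.lt_size i hi
        omega
      · omega
    · simp only [DynArray.elems_set, Array.size_setIfInBounds, g2]
      omega
    · have h1 := hP.time_insert_le htrh (by
        have := (List.filter_sublist (l := List.range n)
          (p := fun i => decide (L i = L n))).length_le
        rw [List.length_range] at this
        rw [List.length_map]
        omega) (I n).fst (I n).snd n
      simp only [DynArray.cap_set]
      omega
  · rename_i h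
    rw [Array.getElem?_eq_none_iff] at h
    omega

/-- The maximum of the stored heights over the endpoints in `I n` is the level of `I n`. -/
theorem maxHeight_eq (hP : Params I L o N M H) {ends : ITree α} {sls : DynArray SLS} {pt : ℕ → α}
    {m : ℕ} (hE : EndsInv I (Covered I L n) M m ends sls pt)
    (hcov : ∀ i < n + 1, ∃ k < sls.elems.size, pt k = (I i).fst) :
    (State.maxHeight sls (ends.intersection (I n).fst (I n).snd).val 0).val = L n := by
  have hS : ∀ k, k ∈ (ends.intersection (I n).fst (I n).snd).val ↔
      k < sls.elems.size ∧ pt k ∈ I n := fun k => by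
    rw [hE.holds.mem_intersection_pointEntry]; rfl
  set S := (ends.intersection (I n).fst (I n).snd).val
  obtain ⟨-, h1, h2, -⟩ := State.maxHeight_spec sls S 0
  have hh : ∀ (k : ℕ) (e : SLS), sls.elems[k]? = some e →
      e.height.val = slsHeight I L n (pt k) := by
    intro k e he
    obtain ⟨v1, v2, -⟩ := hE.valid k e he
    obtain ⟨w1, w2⟩ := v1.height
    symm
    refine slsHeight_eq (fun y hy => (v2 y).1 (w1 y hy)) fun j hj ht e' => ?_
    exact w2 ((v2 _).2 ⟨j, hj, ht, e'⟩)
  have hget : ∀ k ∈ S, ∃ e, sls.elems[k]? = some e := fun k hk =>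
    ⟨_, Array.getElem?_eq_getElem ((hS k).1 hk).1⟩
  obtain ⟨⟨t, ht, et⟩, hmax⟩ := hP.kt.level n
  refine le_antisymm ?_ ?_
  · rcases h2 with h2 | ⟨k, hk, e, he, h⟩
    · rw [h2]; exact Nat.zero_le _
    · rw [← h, hh k e he]
      exact hmax ⟨pt k, ((hS k).1 hk).2, rfl⟩
  · obtain ⟨k₀, hk₀, e₀⟩ := hcov n (by omega)
    -- The last stored point between the left end of I n and t; the left end of I n itself shows
    -- that one exists. An earlier interval through t starts before I n or at a stored point in this
    -- range, hence not after the chosen point, which it therefore contains.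
    obtain ⟨k, hk, hkmax⟩ := Finset.exists_max_image
      ((Finset.range sls.elems.size).filter fun k => (I n).fst ≤ pt k ∧ pt k ≤ t) pt
      ⟨k₀, by simp [hk₀, e₀, ht.1]⟩
    simp only [Finset.mem_filter, Finset.mem_range] at hk hkmax
    have hkS : k ∈ S := (hS k).2 ⟨hk.1, hk.2.1, hk.2.2.trans ht.2⟩
    obtain ⟨e, he⟩ := hget k hkS
    refine le_trans ?_ (h1 k hkS e he)
    rw [et, hh k e he]
    refine slsHeight_le_slsHeight fun j hj htj => ⟨hj, ?_, hk.2.2.trans htj.2⟩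
    rcases le_total (I j).fst (I n).fst with hle | hle
    · exact hle.trans hk.2.1
    · obtain ⟨k', hk', e'⟩ := hcov j (by omega)
      rw [← e']
      exact hkmax k' ⟨hk', e' ▸ hle, e' ▸ htj.1⟩

/-- The coefficient 188 is 29 + 53 + 53 + 12 + 41: insertion into the interval tree, two endpoints,
the query for S, and the offset. The coefficient 300 has some slack and absorbs the additive
constants. -/
theorem handleInsert_spec (hP : Params I L o N M H) (hn : n < N) {s : State α}
    (hs : StateInv I L o M n s) :
    StateInv I L o M (n + 1) (s.handleInsert (I n)).val ∧
      (s.handleInsert (I n)).time + s.pot ≤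
        (s.handleInsert (I n)).val.pot + 188 * H + 300 * (M + 1) := by
  obtain ⟨hiv, hcw, hcs, hco, hT, pt, hE, hcov⟩ := hs
  have t1 := hP.time_insert_le hiv (by rw [List.length_map, List.length_range]; omega)
    (I n).fst (I n).snd n
  have t2 := hcw.time_push_le ⟨none, none⟩
  have hlev : ∀ j l, State.levelAt (s.colors.push ⟨none, none⟩).val j = some l ↔
      j < n ∧ L j = l := by
    intro j l
    rw [State.levelAt, DynArray.elems_push, Array.getElem?_push, hcs]
    split
    · simp; omega
    · by_cases hj : j < n
      · simp [hco j hj, hj]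
      · rw [Array.getElem?_eq_none (by omega)]
        simp [hj]
  have hiv' : (ITree.insert (I n).fst (I n).snd n s.ivals).val.Holds
      ((List.range (n + 1)).map (entry I)) := by
    refine hiv.insert ?_
    rw [List.range_succ, List.map_append]
    exact List.perm_append_comm
  -- During the insertion endpoints of n + 1 intervals are admitted while the flags still describe
  -- the first n; `updateEndpoints` closes this gap.
  have hE' : EndsInv I (Covered I L n) M (n + 1) s.ends s.sls pt :=
    ⟨hE.wf, ⟨hE.isEndpoints.inj, fun k hk =>
      let ⟨i, hi, h⟩ := hE.isEndpoints.mem k hk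
      ⟨i, by omega, h⟩⟩, hE.holds, hE.valid⟩
  simp only [State.handleInsert, State.computeMaxSLS, Timed.val_bind, Timed.time_bind, Timed.val_op,
    Timed.time_op, DynArray.val_size, DynArray.time_size, DynArray.time_set, hcs]
  set cs := s.colors.push ⟨none, none⟩
  set iv := ITree.insert (I n).fst (I n).snd n s.ivals
  set s1 : State α := { s with ivals := iv.val, colors := cs.val }
  obtain ⟨a1, a2, a3, ⟨pt2, a4, a5, a6⟩, a7⟩ :=
    hP.addEndpoint_spec hn (s := s1) hiv' hlev hE' (Or.inl rfl)
  set s2 := s1.addEndpoint (I n).fst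
  obtain ⟨b1, b2, b3, ⟨pt3, b4, b5, b6⟩, b7⟩ :=
    hP.addEndpoint_spec hn (s := s2.val) (by rw [a1]; exact hiv') (by rw [a2]; exact hlev) a4
      (Or.inr rfl)
  set s3 := s2.val.addEndpoint (I n).snd
  have hcov3 : ∀ i < n + 1, ∃ k < s3.val.sls.elems.size, pt3 k = (I i).fst := by
    intro i hi
    have : ∃ k < s2.val.sls.elems.size, pt2 k = (I i).fst := by
      rcases Nat.lt_succ_iff_lt_or_eq.1 hi with hi | rfl
      · obtain ⟨k, hk, e⟩ := hcov i hi
        obtain ⟨k', hk', e'⟩ := a6 k hk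
        exact ⟨k', hk', e'.trans e⟩
      · exact a5
    obtain ⟨k, hk, e⟩ := this
    obtain ⟨k', hk', e'⟩ := b6 k hk
    exact ⟨k', hk', e'.trans e⟩
  obtain ⟨q1, q2⟩ := hP.intersection_pointEntry (Nat.succ_le_of_lt hn) hn b4.isEndpoints b4.holds
    le_rfl le_rfl
  have hS : ∀ k, k ∈ (s3.val.ends.intersection (I n).fst (I n).snd).val ↔
      k < s3.val.sls.elems.size ∧ pt3 k ∈ I n := fun k => by
    rw [b4.holds.mem_intersection_pointEntry]; rfl
  have hmx := hP.maxHeight_eq b4 hcov3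
  set S := s3.val.ends.intersection (I n).fst (I n).snd
  obtain ⟨-, -, -, m4⟩ := State.maxHeight_spec s3.val.sls S.val 0
  rw [hmx]
  have hvalid : ∀ (k : ℕ) (e : SLS), s3.val.sls.elems[k]? = some e → e.Valid :=
    fun k e he => (b4.valid k e he).1
  obtain ⟨u1, u2, u3, u4⟩ := State.updateEndpoints_spec (L n) S.val s3.val.sls hvalid
  set up := State.updateEndpoints (L n) S.val s3.val.sls
  set cs1 := s3.val.colors.set n ⟨some (L n), none⟩
  have hcol : s3.val.colors = cs.val := b2.trans a2
  have htab : s3.val.table = s.table := b3.trans a3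
  have hcssz : cs.val.elems.size = n + 1 := by simp [cs, hcs]
  have hcsold : ∀ j < n, cs.val.elems[j]? = some ⟨some (L j), some (o j)⟩ := by
    intro j hj
    rw [DynArray.elems_push, Array.getElem?_push, if_neg (by omega)]
    exact hco j hj
  set s4 : State α := { s3.val with colors := cs1.val, sls := up.val }
  obtain ⟨T, c1, c2, c3⟩ := hP.computeOffset_spec hn (s := s4) (by
    intro j hj
    simp only [State.offsetAt, s4, cs1, DynArray.elems_set, Array.getElem?_setIfInBounds]
    rw [if_neg (by omega), hcol, hcsold j hj]
    rfl) (by simpa [s4, htab] using hT)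
  rw [c1]
  have hcap : s4.table.cap = s.table.cap := by simp only [s4, htab]
  have hLn := hP.level_le n hn
  constructor
  · refine ⟨?_, ?_, ?_, ?_, c2, pt3, ⟨?_, ?_, ?_, ?_⟩, ?_⟩
    · change s3.val.ivals.Holds _
      rw [b1, a1]
      exact hiv'
    · exact DynArray.WF.set (DynArray.WF.set (hcol ▸ hcw.push _) _ _) _ _
    · simp [s4, cs1, hcol, hcssz]
    · intro i hi
      simp only [s4, cs1, DynArray.elems_set, Array.getElem?_setIfInBounds,
        Array.size_setIfInBounds, hcol, hcssz]
      rcases Nat.lt_succ_iff_lt_or_eq.1 hi with hi | rfl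
      · simp only [if_neg (show n ≠ i by omega)]
        exact hcsold i hi
      · simp
    · exact ⟨by simpa [s4, u1, u2] using b4.wf.size_le, by simpa [s4, u1, u2] using b4.wf.cap_le⟩
    · simpa only [s4, u1] using b4.isEndpoints
    · simpa only [s4, u1] using b4.holds
    · intro k e he
      have hk : k < s3.val.sls.elems.size := u1 ▸ (Array.getElem?_eq_some_iff.1 he).1
      have hk' := Array.getElem?_eq_getElem hk
      obtain ⟨e', d1, d2, d3, d4⟩ := u3 k _ hk'
      obtain ⟨-, v2, v3⟩ := b4.valid k _ hk'
      have : e' = e := Option.some.inj (d1.symm.trans he)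
      subst this
      refine ⟨d2, fun l => ?_, by omega⟩
      rw [d3, v2, hS]
      constructor
      · rintro (⟨j, hj, h⟩ | ⟨⟨-, h⟩, rfl⟩)
        · exact ⟨j, by omega, h⟩
        · exact ⟨n, by omega, h, rfl⟩
      · rintro ⟨j, hj, h1, h2⟩
        rcases Nat.lt_succ_iff_lt_or_eq.1 hj with hj | rfl
        · exact Or.inl ⟨j, hj, h1, h2⟩
        · exact Or.inr ⟨⟨hk, h1⟩, h2.symm⟩
    · simpa only [s4, u1] using hcov3
  · have e1 : s1.sls = s.sls := rfl
    have e2 : cs1.val.cap = cs.val.cap := by simp only [cs1, DynArray.cap_set, hcol]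
    have e3 : s4.sls = up.val := rfl
    have e4 : s4.colors.cap = cs.val.cap := e2
    simp only [State.pot, DynArray.cap_set, e3, e4, u2]
    rw [e1] at a7
    rw [hcap] at c3
    omega

theorem run_spec (hP : Params I L o N M H) (hn : n ≤ N) :
    StateInv I L o M n (run I n).val ∧
      (run I n).time ≤ (run I n).val.pot + n * (188 * H + 300 * (M + 1)) := by
  induction n with
  | zero =>
    refine ⟨⟨.leaf, .empty, rfl, by simp, ⟨.empty, ?_, by simp, ?_⟩,
      fun _ => (I 0).fst, ⟨.empty, ⟨?_, ?_⟩, .leaf, ?_⟩, by simp⟩, ?_⟩ <;>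
      simp [run, State.init, DynArray.empty]
  | succ n ih =>
    obtain ⟨h1, h2⟩ := ih (by omega)
    obtain ⟨h3, h4⟩ := hP.handleInsert_spec (by omega) h1
    simp only [run, Timed.val_bind, Timed.time_bind]
    refine ⟨h3, ?_⟩
    rw [Nat.succ_mul]
    omega

end Params

/-! ### Total running time and the theorem -/

theorem StateInv.pot_le {s : State α} (h : StateInv I L o M n s) :
    s.pot ≤ 6 * n + 12 * n + 48 * n * (M + 1) + 6 * (M + 1) := by
  obtain ⟨-, hcw, hcs, -, hT, pt, hE, -⟩ := h
  have h1 := hcw.cap_le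
  have h2 := hE.wf.cap_le
  have h3 := hE.isEndpoints.le
  have h4 := hT.wf.cap_le
  have h5 := hT.size_le
  -- A line segment has at most M + 1 cells, each of potential at most 24: the weight 12 and three
  -- times the capacities, which are at most twice the sizes of the two arrays.
  have h6 : State.slsPot s.sls ≤ s.sls.elems.size * (24 * (M + 1)) := by
    have := List.sum_le_card_nsmul (s.sls.elems.toList.map SLS.pot) (24 * (M + 1)) (by
      intro x hx
      obtain ⟨e, he, rfl⟩ := List.mem_map.1 hx
      obtain ⟨k, hk⟩ := List.getElem?_of_mem he
      obtain ⟨v1, -, v2⟩ := hE.valid k e (by simpa using hk)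
      exact v1.pot_le.trans (Nat.mul_le_mul_left _ v2))
    simpa [State.slsPot] using this
  have h7 : s.sls.elems.size * (24 * (M + 1)) ≤ 2 * n * (24 * (M + 1)) := Nat.mul_le_mul_right _ h3
  have h8 : 2 * n * (24 * (M + 1)) = 48 * n * (M + 1) := by ring
  unfold State.pot
  omega

theorem time_run_le (I : ℕ → NonemptyInterval α) {n : ℕ} (hn : 1 ≤ n) :
    (run I n).time ≤ n * (376 * Nat.log 2 (2 * n + 1) + 560 * (maxDeg I n + 1)) := by
  have hP : Params I (ktLevel I) (ktOffset I (ktLevel I)) n (maxDeg I n)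
      (2 * Nat.log 2 (2 * n + 1) + 1) :=
    ⟨isKTSLS_ktLevel I, fun i hi => card_meets_le I hi,
      fun i hi => (isLevel_ktLevel I).le_maxDeg hi, rfl⟩
  obtain ⟨h1, h2⟩ := hP.run_spec le_rfl
  have h3 := h1.pot_le
  generalize maxDeg I n = D at *
  generalize Nat.log 2 (2 * n + 1) = l at *
  -- Twice 188 gives 376. The rest is 300 + 48 + 6 times D + 1, with 6(D + 1) ≤ 6n(D + 1), and 188 +
  -- 18 = 206 as constant, 560 in all.
  nlinarith [Nat.mul_le_mul hn (Nat.le_add_left 1 D), Nat.zero_le (n * D)]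

theorem color_run (I : ℕ → NonemptyInterval α) {n i : ℕ} (hi : i < n) :
    (run I n).val.color i = some (ktLevel I i, ktOffset I (ktLevel I) i) := by
  have hP : Params I (ktLevel I) (ktOffset I (ktLevel I)) n (maxDeg I n)
      (2 * Nat.log 2 (2 * n + 1) + 1) :=
    ⟨isKTSLS_ktLevel I, fun i hi => card_meets_le I hi,
      fun i hi => (isLevel_ktLevel I).le_maxDeg hi, rfl⟩
  simp [State.color, (hP.run_spec le_rfl).1.colors i hi]

theorem log_two_mul_add_one_le {n : ℕ} (hn : 2 ≤ n) :
    (Nat.log 2 (2 * n + 1) : ℝ) ≤ 5 * Real.log n := by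
  have hn' : (2 : ℝ) ≤ n := by exact_mod_cast hn
  have h0 : (1 : ℝ) / 2 < Real.log 2 := by linarith [Real.log_two_gt_d9]
  have h1 : ((2 : ℕ) ^ Nat.log 2 (2 * n + 1) : ℝ) ≤ 2 * n + 1 := by
    exact_mod_cast Nat.pow_log_le_self 2 (by omega)
  have h2 : (Nat.log 2 (2 * n + 1) : ℝ) * Real.log 2 ≤ Real.log (2 * n + 1) := by
    rw [← Real.log_pow]
    exact Real.log_le_log (by positivity) (by exact_mod_cast h1)
  have h3 : Real.log (2 * n + 1) ≤ 5 / 2 * Real.log n := by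
    have h4 : Real.log (2 * n + 1) ≤ 1 / 2 * Real.log ((n : ℝ) ^ 5) := by
      rw [← Real.log_rpow (by positivity), ← Real.sqrt_eq_rpow]
      refine Real.log_le_log (by positivity) (Real.le_sqrt_of_sq_le ?_)
      -- For n ≥ 2 one has (2n + 1)² ≤ 8n² ≤ n⁵, hence the exponent 5/2; dividing by log 2 > 1/2
      -- turns it into the factor 5.
      have : (8 : ℝ) * n ^ 2 ≤ n ^ 5 := by
        have h8 : (2 : ℝ) ^ 3 ≤ n ^ 3 := by gcongr
        nlinarith [sq_nonneg (n : ℝ)]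
      nlinarith
    rw [Real.log_pow] at h4
    push_cast at h4
    linarith
  have h5 : (0 : ℝ) ≤ Nat.log 2 (2 * n + 1) := Nat.cast_nonneg _
  nlinarith

end IntervalColoring

theorem mainTheorem1 :
    ∃ C : ℝ, 0 < C ∧ ∀ I : ℕ → NonemptyInterval ℝ,
      -- total time of `n` insertions, that is, `n` times the amortized time per insertion
      (∀ n : ℕ, 2 ≤ n →
        ((IntervalColoring.run I n).time : ℝ) ≤
          n * (C * (Real.log n + IntervalColoring.maxDeg I n))) ∧
      -- the stored colours are those of KT-SLS, after every insertion
      (∃ L o : ℕ → ℕ, IntervalColoring.IsKTSLS I L o ∧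
        ∀ n : ℕ, ∀ i < n, (IntervalColoring.run I n).val.color i = some (L i, o i)) ∧
      -- after every insertion the colouring is proper and uses at most `3ω - 2` colours
      (∀ n : ℕ, ∀ i j : Fin n, (IntervalColoring.intervalGraph I n).Adj i j →
        (IntervalColoring.run I n).val.color i ≠ (IntervalColoring.run I n).val.color j) ∧
      (∀ n : ℕ, 1 ≤ n →
        ((Finset.range n).image
          fun i => (IntervalColoring.run I n).val.color i).card + 2 ≤
            3 * (IntervalColoring.intervalGraph I n).cliqueNum) := by
  open IntervalColoring in
  -- 3000 = 5 · 376 + 2 · 560: the second term absorbs the constant 560, because log n ≥ 1/2 for n ≥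
  -- 2.
  refine ⟨3000, by norm_num, fun I => ⟨fun n hn => ?_,
    ⟨_, _, isKTSLS_ktLevel I, fun n i hi => color_run I hi⟩, fun n i j hij => ?_, fun n hn => ?_⟩⟩
  · have h1 : ((run I n).time : ℝ) ≤
        n * (376 * Nat.log 2 (2 * n + 1) + 560 * (maxDeg I n + 1)) := by
      exact_mod_cast time_run_le I (by omega)
    refine h1.trans (mul_le_mul_of_nonneg_left ?_ (Nat.cast_nonneg n))
    have h2 := log_two_mul_add_one_le hn
    have h3 : (1 : ℝ) / 2 ≤ Real.log n := by
      have : Real.log 2 ≤ Real.log n := Real.log_le_log (by norm_num) (by exact_mod_cast hn)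
      linarith [Real.log_two_gt_d9]
    have h4 : (0 : ℝ) ≤ maxDeg I n := Nat.cast_nonneg _
    linarith
  · rw [color_run I i.2, color_run I j.2, Ne, Option.some.injEq]
    rcases lt_or_gt_of_ne (Fin.val_ne_of_ne hij.1) with h | h
    · exact (isKTSLS_ktLevel I).ne_of_meets h hij.2
    · exact ((isKTSLS_ktLevel I).ne_of_meets h hij.2.symm).symm
  · refine le_trans ?_ ((isKTSLS_ktLevel I).card_colors_le hn)
    have : (Finset.range n).image (fun i => (run I n).val.color i) =
        ((Finset.range n).image fun i => (ktLevel I i, ktOffset I (ktLevel I) i)).image some := by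
      rw [Finset.image_image]
      exact Finset.image_congr fun i hi => color_run I (by simpa using hi)
    rw [this]
    exact Nat.add_le_add_right Finset.card_image_le 2
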